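/- **Setting.** Let $\Omega$ be the space of environments on $\mathbb Z$, i.e. of families $\omega=(\pi_{ij})_{i,j\in\mathbb Z}\in[0,1]^{\mathbb Z\times\mathbb Z}$ with $\sum_{j}\pi_{ij}=1$ for every $i$, with its product $\sigma$-field and the shifts $(T^k\omega)_{ij}=\omega_{k+i,k+j}$, $k\in\mathbb Z$. Let $\mathbb P$ be a probability measure on $\Omega$ that is $T$-invariant and ergodic (not necessarily a product measure). For $x\in\mathbb Z$ let $P_x^\omega$ (the quenched law) be the law of the Markov chain $(X_n)_{n\ge0}$ on $\mathbb Z$ with $X_0=x$ and transition probabilities $P_x^\omega(X_{n+1}=j\mid X_n=i)=\pi_{ij}(\omega)$, let $P_x=\int P_x^\omega\,d\mathbb P(\omega)$ (the annealed law, regarded as a law of the pair $(\omega,(X_n)_{n\ge0})$), and let $E_x^\omega$, $E_x$ be the corresponding expectations. Put $D(\omega)=\sum_i i\,\pi_{0i}(\omega)$. Assume that the walk has finite range: there is an integer $M\ge0$ with $\mathbb P(\pi_{ij}=0\text{ whenever }|i-j|>M)=1$. Assume that Kalikow's condition with $\ell=1$ holds, namely: (a) there is $\kappa\in(0,1)$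 with $\mathbb P(\pi_{ij}>\kappa\text{ whenever }|i-j|\le M)=1$; (b) $$\inf_{U}\ \inf_{x\in U}\ \frac{E_0\Big(\sum_{j=0}^{T_U}\mathbf 1(X_j=x)\,D(T^{X_j}\omega)\Big)}{E_0\Big(\sum_{j=0}^{T_U}\mathbf 1(X_j=x)\Big)}=\varepsilon>0,$$ where $T_U=\inf\{j\ge0:X_j\notin U\}$ and $U$ ranges over all finite subsets of $\mathbb Z$ that contain $0$ and are $M$-connected, i.e. such that some finite path in $U$ with steps of size at most $M$ passes through all points of $U$. For $i\le j$ let $g_{ij}(\omega)=\sum_{n\ge0}P_i^\omega(X_n=j)$ be the Green function and $G_{ij}=\frac1{j-i+1}\sum_{k=i}^{j}g_{kj}$ its average. **Theorem.** There is a probability measure $\mathbb P_\infty$ on $\Omega$ such that: 1. $\mathbb P_\infty$ is invariant for the environment process $(T^{X_n}\omega)_{n\ge0}$, i.e. for the Markov chain on $\Omega$ that moves from $\omega$ to $T^e\omega$ with probability $\pi_{0e}(\omega)$; 2. $\mathbb P_\infty$ is absolutely continuous with respect to $\mathbb P$; more precisely, there are integers $0\le n_1<n_2<\cdots$ and a function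 $\mu_0\ge0$ in $L^1(\Omega,\mathbb P)$ with $\int\mu_0\,d\mathbb P>0$ such that the functions $G_{-n_k,0}$ are in $L^1(\Omega,\mathbb P)$ and converge to $\mu_0$ weakly in $L^1(\Omega,\mathbb P)$ as $k\to\infty$, and $$\frac{d\mathbb P_\infty}{d\mathbb P}=\frac{\mu_0}{\int\mu_0\,d\mathbb P};$$ 3. $D$ is $\mathbb P_\infty$-integrable, and the law of large numbers holds: $$P_0\Big(\lim_{n\to\infty}\frac{X_n}{n}=\mathbb E^{\mathbb P_\infty}(D)\Big)=1 .$$ -/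

import Mathlib

open MeasureTheory ProbabilityTheory Filter Topology
open scoped ENNReal

namespace RWRE

/-- Environments on `ℤ`: transition probabilities `ω i j = π_{ij} ∈ [0,1]` with `∑ j, π_{ij} = 1`,
with the σ-algebra induced by the product σ-algebra of `ℤ → ℤ → ℝ`. -/
abbrev Env : Type :=
  {ω : ℤ → ℤ → ℝ // (∀ i j, ω i j ∈ Set.Icc (0 : ℝ) 1) ∧ ∀ i, HasSum (ω i) 1}

/-- The natural shift, `(T^k ω)_{ij} = ω_{k+i,k+j}`. -/
def shift (k : ℤ) (ω : Env) : Env :=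
  ⟨fun i j => ω.1 (k + i) (k + j), fun i j => ω.2.1 (k + i) (k + j), fun i =>
    (Equiv.addLeft k).hasSum_iff.mpr (ω.2.2 (k + i))⟩

/-- The probability measure `∑ j, π_{ij} δ_j` on `ℤ`: the law of one step of the walk from `i`. -/
noncomputable def row (ω : Env) (i : ℤ) : Measure ℤ :=
  Measure.sum fun j => ENNReal.ofReal (ω.1 i j) • Measure.dirac j

theorem row_apply (ω : Env) (i : ℤ) (A : Set ℤ) :
    row ω i A = ∑' j, ENNReal.ofReal (ω.1 i j) * A.indicator 1 j := by
  simp [row, Measure.sum_apply _ (MeasurableSet.of_discrete (s := A))]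

theorem row_singleton (ω : Env) (i j : ℤ) : row ω i {j} = ENNReal.ofReal (ω.1 i j) := by
  rw [row_apply, tsum_eq_single j]
  · simp
  · intro b hb; simp [hb]

instance isProbabilityMeasure_row (ω : Env) (i : ℤ) : IsProbabilityMeasure (row ω i) := by
  constructor
  rw [row_apply]
  simp only [Set.indicator_univ, Pi.one_apply, mul_one]
  rw [← ENNReal.ofReal_tsum_of_nonneg (fun j => (ω.2.1 i j).1) (ω.2.2 i).summable,
    (ω.2.2 i).tsum_eq, ENNReal.ofReal_one]

theorem measurable_entry (i j : ℤ) : Measurable fun ω : Env => ω.1 i j :=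
  (measurable_pi_apply j).comp ((measurable_pi_apply i).comp measurable_subtype_coe)

theorem measurable_shift (k : ℤ) : Measurable (shift k) :=
  Measurable.subtype_mk (measurable_pi_lambda _ fun i => measurable_pi_lambda _ fun j =>
    measurable_entry (k + i) (k + j))

/-- The transition kernel of the walk in the environment `ω`. -/
noncomputable def transition (ω : Env) : Kernel ℤ ℤ where
  toFun := row ω
  measurable' := Measurable.of_discrete

instance (ω : Env) : IsMarkovKernel (transition ω) := ⟨isProbabilityMeasure_row ω⟩

/-- The conditional law of `X_{n+1}` given `X_0, …, X_n`: it is `π_{X_n, ·}`. -/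
noncomputable def step (ω : Env) (n : ℕ) : Kernel (Finset.Iic n → ℤ) ℤ :=
  (transition ω).comap (fun h => h ⟨n, Finset.mem_Iic.2 le_rfl⟩) (measurable_pi_apply _)

instance (ω : Env) (n : ℕ) : IsMarkovKernel (step ω n) := by unfold step; infer_instance

/-- The quenched law `P_x^ω`, on the canonical path space `ℕ → ℤ`: the law of the Markov chain
started at `x` with transition probabilities `π_{ij}(ω)`. -/
noncomputable def quenchedLaw (ω : Env) (x : ℤ) : Measure (ℕ → ℤ) :=
  Kernel.traj (X := fun _ => ℤ) (step ω) 0 (fun _ => x)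

instance (ω : Env) (x : ℤ) : IsProbabilityMeasure (quenchedLaw ω x) := by
  unfold quenchedLaw; infer_instance

theorem partialTraj_singleton (ω : Env) (x : ℤ) (n : ℕ) (p : ℕ → ℤ) :
    Kernel.partialTraj (X := fun _ => ℤ) (step ω) 0 n (fun _ => x)
        {Preorder.frestrictLe (π := fun _ => ℤ) n p} =
      (if p 0 = x then 1 else 0) *
        ∏ k ∈ Finset.range n, ENNReal.ofReal (ω.1 (p k) (p (k + 1))) := by
  induction n with
  | zero =>
    rw [Kernel.partialTraj_self, Kernel.id_apply,
      Measure.dirac_apply' _ (measurableSet_singleton _)]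
    by_cases h : p 0 = x
    · have : (fun _ => x : Finset.Iic 0 → ℤ) = Preorder.frestrictLe (π := fun _ => ℤ) 0 p := by
        funext ⟨k, hk⟩
        have : k = 0 := by simpa using hk
        subst this; simp [h]
      simp [h, this]
    · have : (fun _ => x : Finset.Iic 0 → ℤ) ≠ Preorder.frestrictLe (π := fun _ => ℤ) 0 p := by
        intro e
        have := congrFun e ⟨0, by simp⟩
        exact h (by simpa using this.symm)
      simp [h, this]
  | succ n ih =>
    have key : ∀ b : Finset.Iic n → ℤ,
        Kernel.partialTraj (X := fun _ => ℤ) (step ω) n (n + 1) b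
          {Preorder.frestrictLe (π := fun _ => ℤ) (n + 1) p} =
        ENNReal.ofReal (ω.1 (p n) (p (n + 1))) *
        ({Preorder.frestrictLe (π := fun _ => ℤ) n p} : Set (Finset.Iic n → ℤ)).indicator 1 b := by
      intro b
      have hpre : (IicProdIoc (X := fun _ => ℤ) n (n + 1)) ⁻¹'
          {Preorder.frestrictLe (π := fun _ => ℤ) (n + 1) p} =
          ({Preorder.frestrictLe (π := fun _ => ℤ) n p} : Set (Finset.Iic n → ℤ)) ×ˢ
            {fun k : Finset.Ioc n (n + 1) => p k} := by
        ext ⟨u, v⟩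
        simp only [Set.mem_preimage, Set.mem_singleton_iff, Set.mem_prod]
        constructor
        · intro e
          constructor
          · funext ⟨k, hk⟩
            have hk' := Finset.mem_Iic.1 hk
            have := congrFun e ⟨k, Finset.mem_Iic.2 (by omega)⟩
            simpa [IicProdIoc, hk'] using this
          · funext ⟨k, hk⟩
            have hk' := Finset.mem_Ioc.1 hk
            have := congrFun e ⟨k, Finset.mem_Iic.2 (by omega)⟩
            simpa [IicProdIoc, show ¬ k ≤ n by omega] using this
        · rintro ⟨rfl, rfl⟩
          funext ⟨k, hk⟩
          by_cases h : k ≤ n <;> simp [IicProdIoc, h]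
      have hps : (MeasurableEquiv.piSingleton (X := fun _ => ℤ) n) ⁻¹'
          {fun k : Finset.Ioc n (n + 1) => p k} = {p (n + 1)} := by
        ext v
        simp only [Set.mem_preimage, Set.mem_singleton_iff]
        constructor
        · intro e
          have := congrFun e ⟨n + 1, by simp⟩
          simpa [MeasurableEquiv.piSingleton] using this
        · rintro rfl
          funext ⟨k, hk⟩
          have hk' := Finset.mem_Ioc.1 hk
          have : k = n + 1 := by omega
          subst this
          simp [MeasurableEquiv.piSingleton]
      rw [Kernel.partialTraj_succ_self,
        Kernel.map_apply' _ (by fun_prop) _ (measurableSet_singleton _), hpre, Kernel.prod_apply, Measure.prod_prod,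
        Kernel.id_apply, Measure.dirac_apply' _ (measurableSet_singleton _),
        Kernel.map_apply' _ (by fun_prop) _ (measurableSet_singleton _), hps]
      by_cases hb : b = Preorder.frestrictLe (π := fun _ => ℤ) n p
      · subst hb
        simp [step, transition, Kernel.comap_apply, row_singleton]
      · simp [hb]
    rw [Kernel.partialTraj_succ_eq_comp (Nat.zero_le n),
      Kernel.comp_apply' _ _ _ (measurableSet_singleton _)]
    simp_rw [key]
    rw [lintegral_const_mul _ (by fun_prop), lintegral_indicator_one (measurableSet_singleton _), ih,
      Finset.prod_range_succ]
    ring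

/-- The finite-dimensional distributions of the quenched law. -/
theorem quenchedLaw_cylinder (ω : Env) (x : ℤ) (n : ℕ) (p : ℕ → ℤ) :
    quenchedLaw ω x {X | ∀ k ≤ n, X k = p k} =
      (if p 0 = x then 1 else 0) *
        ∏ k ∈ Finset.range n, ENNReal.ofReal (ω.1 (p k) (p (k + 1))) := by
  rw [← partialTraj_singleton, ← Kernel.traj_map_frestrictLe_apply,
    Measure.map_apply (Preorder.measurable_frestrictLe n) (measurableSet_singleton _)]
  congr 1
  ext X
  simp only [Set.mem_ofPred_eq, Set.mem_preimage, Set.mem_singleton_iff]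
  constructor
  · intro h
    funext ⟨k, hk⟩
    exact h k (Finset.mem_Iic.1 hk)
  · intro h k hk
    exact congrFun h ⟨k, Finset.mem_Iic.2 hk⟩

theorem measurable_quenchedLaw (x : ℤ) : Measurable fun ω => quenchedLaw ω x := by
  refine Measurable.measure_of_isPiSystem_of_isProbabilityMeasure
    (generateFrom_measurableCylinders (α := fun _ : ℕ => ℤ)).symm
    (isPiSystem_measurableCylinders (α := fun _ : ℕ => ℤ)) fun A hA => ?_
  obtain ⟨s, S, -, rfl⟩ := (mem_measurableCylinders A).1 hA
  have hs : s ⊆ Finset.Iic (s.sup id) := fun k hk => Finset.mem_Iic.2 (Finset.le_sup (f := id) hk)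
  set N := s.sup id
  set B : Set (Finset.Iic N → ℤ) := Finset.restrict₂ (π := fun _ => ℤ) hs ⁻¹' S
  have h1 : ∀ ω, quenchedLaw ω x (cylinder s S) =
      ∑' b : Finset.Iic N → ℤ, Kernel.partialTraj (X := fun _ => ℤ) (step ω) 0 N (fun _ => x) {b} *
        B.indicator 1 b := by
    intro ω
    have : quenchedLaw ω x (cylinder s S) =
        Kernel.partialTraj (X := fun _ => ℤ) (step ω) 0 N (fun _ => x) B := by
      rw [← Kernel.traj_map_frestrictLe_apply,
        Measure.map_apply (Preorder.measurable_frestrictLe N) MeasurableSet.of_discrete]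
      rfl
    rw [this, ← lintegral_indicator_one MeasurableSet.of_discrete, lintegral_countable']
    exact tsum_congr fun b => mul_comm _ _
  simp_rw [h1]
  refine Measurable.tsum fun b => Measurable.mul_const ?_ _
  let p : ℕ → ℤ := fun k => if h : k ∈ Finset.Iic N then b ⟨k, h⟩ else 0
  have hp : b = Preorder.frestrictLe (π := fun _ => ℤ) N p := by
    funext ⟨k, hk⟩
    have hk' : k ≤ N := Finset.mem_Iic.1 hk
    simp [p, hk']
  rw [hp]
  simp_rw [partialTraj_singleton]
  exact (Finset.measurable_prod _ fun k _ => (measurable_entry _ _).ennreal_ofReal).const_mul _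

/-- The quenched law `P_x^ω`, as a kernel from environments to paths. -/
noncomputable def quenchedKernel (x : ℤ) : Kernel Env (ℕ → ℤ) where
  toFun ω := quenchedLaw ω x
  measurable' := measurable_quenchedLaw x

instance isMarkovKernel_quenchedKernel (x : ℤ) : IsMarkovKernel (quenchedKernel x) :=
  ⟨fun ω => inferInstanceAs (IsProbabilityMeasure (quenchedLaw ω x))⟩

/-- The annealed law `P_x`, as the joint law of the environment `ω` (first coordinate, with law `P`)
and of the walk `(X_n)` (second coordinate, with conditional law `P_x^ω` given `ω`). -/
noncomputable def annealedLaw (P : Measure Env) (x : ℤ) : Measure (Env × (ℕ → ℤ)) :=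
  P ⊗ₘ quenchedKernel x

/-- The transition kernel of the environment viewed from the particle, `(T^{X_n} ω)_{n ≥ 0}`:
from `ω` the process moves to `T^e ω` with probability `π_{0e}(ω)`. -/
noncomputable def envKernel : Kernel Env Env where
  toFun ω := (row ω 0).map fun e => shift e ω
  measurable' := by
    refine Measure.measurable_of_measurable_coe _ fun A hA => ?_
    have : ∀ ω, ((row ω 0).map fun e => shift e ω) A =
        ∑' e, ENNReal.ofReal (ω.1 0 e) * A.indicator 1 (shift e ω) := by
      intro ω
      rw [Measure.map_apply Measurable.of_discrete hA, row_apply]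
      rfl
    simp_rw [this]
    exact Measurable.tsum fun e => (measurable_entry 0 e).ennreal_ofReal.mul
      ((measurable_one.indicator hA).comp (measurable_shift e))

/-- The drift `D(ω) = ∑ i, i π_{0i}(ω)`. -/
noncomputable def drift (ω : Env) : ℝ := ∑' i : ℤ, (i : ℝ) * ω.1 0 i

/-- The walk has finite range `M`. -/
def FiniteRange (P : Measure Env) (M : ℕ) : Prop :=
  ∀ᵐ ω ∂P, ∀ i j : ℤ, (M : ℤ) < |i - j| → ω.1 i j = 0

/-- The uniform ellipticity condition (for range `M`). -/
def UniformlyElliptic (P : Measure Env) (M : ℕ) : Prop :=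
  ∃ κ : ℝ, 0 < κ ∧ κ < 1 ∧ ∀ᵐ ω ∂P, ∀ i j : ℤ, |i - j| ≤ (M : ℤ) → κ < ω.1 i j

/-- `U` is `M`-connected: there is a path in `U`, with steps of size at most `M`, that passes
through all the points of `U`. -/
def MConnected (M : ℕ) (U : Finset ℤ) : Prop :=
  ∃ l : List ℤ, l.IsChain (fun a b => |b - a| ≤ (M : ℤ)) ∧ ∀ z, z ∈ l ↔ z ∈ U

/-- The exit time `T_U = inf {j ≥ 0 : X_j ∉ U}`, which is `⊤` for a path that stays in `U`. -/
noncomputable def exitTime (U : Finset ℤ) (X : ℕ → ℤ) : ℕ∞ :=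
  sInf {t | ∃ j : ℕ, X j ∉ U ∧ t = j}

open Classical in
/-- The quotient in Kalikow's condition (in dimension one, with `ℓ = 1`),
`E_0 (∑_{j=0}^{T_U} 1(X_j = x) D(T^{X_j} ω)) / E_0 (∑_{j=0}^{T_U} 1(X_j = x))`. -/
noncomputable def kalikowQuotient (P : Measure Env) (U : Finset ℤ) (x : ℤ) : ℝ :=
  (∫ q, (∑' j : ℕ, if (j : ℕ∞) ≤ exitTime U q.2 ∧ q.2 j = x then drift (shift (q.2 j) q.1) else 0)
      ∂annealedLaw P 0) /
    ∫ q, (∑' j : ℕ, if (j : ℕ∞) ≤ exitTime U q.2 ∧ q.2 j = x then (1 : ℝ) else 0)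
      ∂annealedLaw P 0

/-- Kalikow's condition with `ℓ = 1`, for a walk of range `M`: uniform ellipticity (which makes
all the expectations below finite), and the infimum, over the finite `M`-connected
sets `U` that contain `0` and over `x ∈ U`, of the Kalikow quotients is some `ε > 0`. -/
def KalikowCondition (P : Measure Env) (M : ℕ) : Prop :=
  UniformlyElliptic P M ∧
    ∃ ε : ℝ, 0 < ε ∧
      IsGLB {r | ∃ U : Finset ℤ, (0 : ℤ) ∈ U ∧ MConnected M U ∧
        ∃ x ∈ U, r = kalikowQuotient P U x} ε

/-- The Green function `g_{ij}(ω) = ∑_{n ≥ 0} P_i^ω(X_n = j)`. -/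
noncomputable def green (i j : ℤ) (ω : Env) : ℝ≥0∞ :=
  ∑' n : ℕ, quenchedLaw ω i {X | X n = j}

/-- The averaged Green function `G_{ij} = (j - i + 1)⁻¹ ∑_{k=i}^{j} g_{kj}`, for `i ≤ j`. -/
noncomputable def avgGreen (i j : ℤ) (ω : Env) : ℝ≥0∞ :=
  (∑ k ∈ Finset.Icc i j, green k j ω) / ((Finset.Icc i j).card : ℝ≥0∞)

/-- A nonnegative function belongs to `L¹(P)`. -/
def MemL1 (P : Measure Env) (u : Env → ℝ≥0∞) : Prop :=
  AEMeasurable u P ∧ ∫⁻ ω, u ω ∂P < ∞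

/-- Weak convergence in `L¹(P)` of a sequence of nonnegative functions: convergence when tested
against bounded measurable functions. -/
def TendstoWeaklyL1 (P : Measure Env) (u : ℕ → Env → ℝ≥0∞) (v : Env → ℝ≥0∞) : Prop :=
  (∀ n, MemL1 P (u n)) ∧ MemL1 P v ∧
    ∀ f : Env → ℝ, Measurable f → (∃ C : ℝ, ∀ ω, |f ω| ≤ C) →
      Tendsto (fun n => ∫ ω, (u n ω).toReal * f ω ∂P) atTop (𝓝 (∫ ω, (v ω).toReal * f ω ∂P))

end RWRE

open RWRE

/-! Kalikow's condition is used for intervals `[-L, N]` only. It says that the mean time spent at a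
site, multiplied by `ε`, is at most the mean drift collected there. Summed over the sites, the
collected drift is the mean exit position, which is at most `N + M`, so the mean exit time is at
most `(N + M) / ε` uniformly in `L` (`Setting.lintegral_pot_Icc_le`). Hence the walk crosses every
level on its right, in a mean time linear in the level.

On its way right the walk cannot jump over a window of `M` consecutive sites, and from each site of
a window it jumps to any fixed site of that window with probability larger than `κ`. This has two
consequences. The first is that the visits from `0` to `j ≥ 0` number on average at least `κ` times
the visits from `j` to itself. Summing over `0 ≤ j ≤ n` and using stationarity, the linear bound on
exit times gives the integrability of `g_{00}` (`Setting.lintegral_pot_univ_ne_top`). The second is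
that a bounded harmonic function on a left half-line loses a factor `1 - κ` of its oscillation every
`M` sites (`Transient.oscillation_le`). So `g_{k0}` has a limit as `k → -∞`, and bounded harmonic
functions on `ℤ` are constant (`Transient.harmonic_eq`).

The limit `limitGreen` lies between `κ` and `g_{00}`, and dominated convergence gives the weak `L¹`
convergence of the averages along the whole sequence. Passing to the limit in the last-step
decomposition of `g_{k0}` shows that `limitGreen` is an invariant density
(`Setting.invariant_invariantMeasure`).

For the law of large numbers, let `v` be the mean drift under the invariant measure and take `s * v
< c`. The event that `s X_n - c n` is unbounded above has a quenched probability that is harmonic in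
the starting point, hence independent of it, hence by ergodicity a constant `p`. Given this event
the first step keeps its law, while the increments are stationary under the invariant measure. The
maximal ergodic theorem on this event gives `0 ≤ p (s v - c)`, so `p = 0`
(`Setting.ae_fastPaths_eq_zero`). Taking `s = 1` and `s = -1` bounds the speed on both sides. -/

namespace RWRE

/-! ### Quenched laws: cylinders, Markov property, translations. -/

/-- Two finite measures on the path space that agree on the cylinders are equal. -/
theorem ext_of_cylinder {μ ν : Measure (ℕ → ℤ)} [IsFiniteMeasure μ]
    (h : ∀ (n : ℕ) (p : ℕ → ℤ), μ {X | ∀ k ≤ n, X k = p k} = ν {X | ∀ k ≤ n, X k = p k}) :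
    μ = ν := by
  have hmap : ∀ N : ℕ, μ.map (Preorder.frestrictLe (π := fun _ => ℤ) N) =
      ν.map (Preorder.frestrictLe (π := fun _ => ℤ) N) := by
    intro N
    refine Measure.ext_of_singleton fun b => ?_
    have hm := Preorder.measurable_frestrictLe (X := fun _ : ℕ => ℤ) N
    rw [Measure.map_apply hm (measurableSet_singleton _),
      Measure.map_apply hm (measurableSet_singleton _)]
    let p : ℕ → ℤ := fun k => if h : k ∈ Finset.Iic N then b ⟨k, h⟩ else 0
    have hs : (Preorder.frestrictLe (π := fun _ => ℤ) N) ⁻¹' {b} = {X | ∀ k ≤ N, X k = p k} := by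
      ext X
      simp only [Set.mem_preimage, Set.mem_singleton_iff, Set.mem_ofPred_eq]
      constructor
      · rintro rfl k hk
        simp [p, hk]
      · intro hX
        funext ⟨k, hk⟩
        have := hX k (Finset.mem_Iic.1 hk)
        simpa [p, Finset.mem_Iic.1 hk] using this
    rw [hs, h]
  have hcyl : ∀ (N : ℕ) (B : Set (Finset.Iic N → ℤ)),
      μ ((Preorder.frestrictLe (π := fun _ => ℤ) N) ⁻¹' B) =
        ν ((Preorder.frestrictLe (π := fun _ => ℤ) N) ⁻¹' B) := by
    intro N B
    have hm := Preorder.measurable_frestrictLe (X := fun _ : ℕ => ℤ) N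
    rw [← Measure.map_apply hm MeasurableSet.of_discrete,
      ← Measure.map_apply hm MeasurableSet.of_discrete, hmap]
  refine MeasureTheory.ext_of_generate_finite _
    (generateFrom_measurableCylinders (α := fun _ : ℕ => ℤ)).symm
    (isPiSystem_measurableCylinders (α := fun _ : ℕ => ℤ)) (fun A hA => ?_) ?_
  · obtain ⟨s, S, -, rfl⟩ := (mem_measurableCylinders A).1 hA
    have hs : s ⊆ Finset.Iic (s.sup id) :=
      fun k hk => Finset.mem_Iic.2 (Finset.le_sup (f := id) hk)
    exact hcyl _ (Finset.restrict₂ (π := fun _ => ℤ) hs ⁻¹' S)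
  · exact hcyl 0 Set.univ

/-- The path `x, Y 0, Y 1, …`. -/
def consPath (x : ℤ) (Y : ℕ → ℤ) : ℕ → ℤ
  | 0 => x
  | n + 1 => Y n

theorem measurable_consPath (x : ℤ) : Measurable (consPath x) := by
  refine measurable_pi_lambda _ fun n => ?_
  cases n with
  | zero => exact measurable_const
  | succ n => exact measurable_pi_apply n

theorem lintegral_row (ω : Env) (i : ℤ) (f : ℤ → ℝ≥0∞) :
    ∫⁻ e, f e ∂row ω i = ∑' e, ENNReal.ofReal (ω.1 i e) * f e := by
  rw [lintegral_countable']
  exact tsum_congr fun e => by rw [row_singleton, mul_comm]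

/-- The Markov property at time one. -/
theorem quenchedLaw_eq_bind (ω : Env) (x : ℤ) :
    quenchedLaw ω x = (row ω x).bind fun e => (quenchedLaw ω e).map (consPath x) := by
  refine ext_of_cylinder fun n p => ?_
  have hms : MeasurableSet {X : ℕ → ℤ | ∀ k ≤ n, X k = p k} := by
    have : {X : ℕ → ℤ | ∀ k ≤ n, X k = p k} = ⋂ k ∈ Finset.Iic n, (fun X => X k) ⁻¹' {p k} := by
      ext; simp
    rw [this]
    exact Finset.measurableSet_biInter _ fun k _ => measurable_pi_apply k (measurableSet_singleton _)
  rw [Measure.bind_apply hms Measurable.of_discrete.aemeasurable, quenchedLaw_cylinder,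
    lintegral_row]
  simp_rw [Measure.map_apply (measurable_consPath x) hms]
  cases n with
  | zero =>
    have hs : ∀ e, quenchedLaw ω e (consPath x ⁻¹' {X : ℕ → ℤ | ∀ k ≤ 0, X k = p k}) =
        if p 0 = x then 1 else 0 := by
      intro e
      have : consPath x ⁻¹' {X : ℕ → ℤ | ∀ k ≤ 0, X k = p k} = {_Y | p 0 = x} := by
        ext Y
        simp [consPath, eq_comm]
      rw [this]
      by_cases h : p 0 = x <;> simp [h]
    simp_rw [hs]
    rw [ENNReal.tsum_mul_right]
    have := (lintegral_row ω x 1).symm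
    simp only [Pi.one_apply, mul_one, lintegral_one, measure_univ] at this
    rw [this]
    simp
  | succ n =>
    have hs : ∀ e, quenchedLaw ω e (consPath x ⁻¹' {X : ℕ → ℤ | ∀ k ≤ n + 1, X k = p k}) =
        (if p 0 = x then 1 else 0) * ((if p 1 = e then 1 else 0) *
          ∏ k ∈ Finset.range n, ENNReal.ofReal (ω.1 (p (k + 1)) (p (k + 1 + 1)))) := by
      intro e
      have : consPath x ⁻¹' {X : ℕ → ℤ | ∀ k ≤ n + 1, X k = p k} =
          {_Y | p 0 = x} ∩ {Y | ∀ k ≤ n, Y k = p (k + 1)} := by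
        ext Y
        simp only [Set.mem_preimage, Set.mem_ofPred_eq, Set.mem_inter_iff]
        constructor
        · intro h
          exact ⟨(h 0 (Nat.zero_le _)).symm, fun k hk => h (k + 1) (by omega)⟩
        · rintro ⟨h0, h⟩ k hk
          cases k with
          | zero => exact h0.symm
          | succ k => exact h k (by omega)
      rw [this]
      by_cases h : p 0 = x
      · simp only [h, Set.ofPred_true, Set.univ_inter, if_true, one_mul]
        exact quenchedLaw_cylinder ω e n fun k => p (k + 1)
      · simp [h]
    simp_rw [hs]
    rw [tsum_eq_single (p 1)]
    · rw [Finset.prod_range_succ']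
      by_cases h : p 0 = x
      · simp [h, mul_comm]
      · simp [h]
    · intro e he
      simp [Ne.symm he]

theorem quenchedLaw_apply (ω : Env) (x : ℤ) {B : Set (ℕ → ℤ)} (hB : MeasurableSet B) :
    quenchedLaw ω x B =
      ∑' e, ENNReal.ofReal (ω.1 x e) * quenchedLaw ω e (consPath x ⁻¹' B) := by
  conv_lhs => rw [quenchedLaw_eq_bind]
  rw [Measure.bind_apply hB Measurable.of_discrete.aemeasurable, lintegral_row]
  exact tsum_congr fun e => by rw [Measure.map_apply (measurable_consPath x) hB]

/-- Translation of paths. -/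
theorem measurable_sub_path (k : ℤ) : Measurable fun (X : ℕ → ℤ) (n : ℕ) => X n - k :=
  measurable_pi_lambda _ fun n =>
    (Measurable.of_discrete (f := fun z : ℤ => z - k)).comp (measurable_pi_apply n)

theorem quenchedLaw_shift (ω : Env) (k x : ℤ) :
    quenchedLaw (shift k ω) x = (quenchedLaw ω (k + x)).map fun X n => X n - k := by
  refine ext_of_cylinder fun n p => ?_
  have hms : MeasurableSet {X : ℕ → ℤ | ∀ k ≤ n, X k = p k} := by
    have : {X : ℕ → ℤ | ∀ k ≤ n, X k = p k} = ⋂ k ∈ Finset.Iic n, (fun X => X k) ⁻¹' {p k} := by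
      ext; simp
    rw [this]
    exact Finset.measurableSet_biInter _ fun k _ => measurable_pi_apply k (measurableSet_singleton _)
  rw [Measure.map_apply (measurable_sub_path k) hms, quenchedLaw_cylinder]
  have : (fun (X : ℕ → ℤ) (n : ℕ) => X n - k) ⁻¹' {X | ∀ k ≤ n, X k = p k} =
      {X | ∀ j ≤ n, X j = k + p j} := by
    ext X
    simp only [Set.mem_preimage, Set.mem_ofPred_eq]
    exact forall₂_congr fun j _ => by rw [sub_eq_iff_eq_add, add_comm]
  rw [this, quenchedLaw_cylinder ω (k + x) n fun j => k + p j]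
  simp [shift]

/-! ### Potential theory of the killed walk. -/

/-- The one-step average `∑ π_{ie} f(e)` for a walk of range `M`, on nonnegative functions. -/
noncomputable def avg (M : ℕ) (ω : Env) (f : ℤ → ℝ≥0∞) (i : ℤ) : ℝ≥0∞ :=
  ∑ e ∈ Finset.Icc (i - M) (i + M), ENNReal.ofReal (ω.1 i e) * f e

/-- The one-step average `∑ π_{ie} h(e)` for a walk of range `M`, on real functions. -/
noncomputable def ravg (M : ℕ) (ω : Env) (h : ℤ → ℝ) (i : ℤ) : ℝ :=
  ∑ e ∈ Finset.Icc (i - M) (i + M), ω.1 i e * h e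

/-- The transition operator of the walk killed after its exit from `U`. -/
noncomputable def killed (M : ℕ) (ω : Env) (U : Set ℤ) (f : ℤ → ℝ≥0∞) : ℤ → ℝ≥0∞ :=
  U.indicator (avg M ω f)

/-- The potential `∑ n, A^n f` of the walk killed after its exit from `U`. -/
noncomputable def pot (M : ℕ) (ω : Env) (U : Set ℤ) (f : ℤ → ℝ≥0∞) (i : ℤ) : ℝ≥0∞ :=
  ∑' n : ℕ, (killed M ω U)^[n] f i

/-- The indicator of a point. -/
noncomputable def delta (j : ℤ) : ℤ → ℝ≥0∞ := ({j} : Set ℤ).indicator 1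

/-- An environment of range `M` whose entries in the range are larger than `κ > 0`. -/
structure Regular (M : ℕ) (κ : ℝ) (ω : Env) : Prop where
  pos : 0 < κ
  range : ∀ i j : ℤ, (M : ℤ) < |i - j| → ω.1 i j = 0
  elliptic : ∀ i j : ℤ, |i - j| ≤ (M : ℤ) → κ < ω.1 i j

variable {M : ℕ} {κ : ℝ} {ω : Env}

theorem avg_mono {f g : ℤ → ℝ≥0∞} (h : f ≤ g) : avg M ω f ≤ avg M ω g := fun _ =>
  Finset.sum_le_sum fun e _ => mul_le_mul_right (h e) _

theorem killed_mono {U V : Set ℤ} (hUV : U ⊆ V) {f g : ℤ → ℝ≥0∞} (h : f ≤ g) :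
    killed M ω U f ≤ killed M ω V g := by
  intro i
  unfold killed
  refine (Set.indicator_le_indicator (avg_mono h i)).trans ?_
  exact Set.indicator_le_indicator_of_subset hUV (fun _ => zero_le) i

theorem iterate_killed_mono {U V : Set ℤ} (hUV : U ⊆ V) {f g : ℤ → ℝ≥0∞} (h : f ≤ g) (n : ℕ) :
    (killed M ω U)^[n] f ≤ (killed M ω V)^[n] g := by
  induction n with
  | zero => exact h
  | succ n ih =>
    rw [Function.iterate_succ_apply', Function.iterate_succ_apply']
    exact killed_mono hUV ih

theorem pot_mono {U V : Set ℤ} (hUV : U ⊆ V) {f g : ℤ → ℝ≥0∞} (h : f ≤ g) (i : ℤ) :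
    pot M ω U f i ≤ pot M ω V g i :=
  ENNReal.tsum_le_tsum fun n => iterate_killed_mono hUV h n i

theorem killed_tsum {ι : Type*} (U : Set ℤ) (f : ι → ℤ → ℝ≥0∞) (i : ℤ) :
    killed M ω U (fun e => ∑' a, f a e) i = ∑' a, killed M ω U (f a) i := by
  unfold killed
  by_cases hi : i ∈ U
  · simp only [Set.indicator_of_mem hi, avg]
    rw [Summable.tsum_finsetSum fun _ _ => ENNReal.summable]
    exact Finset.sum_congr rfl fun e _ => ENNReal.tsum_mul_left.symm
  · simp [Set.indicator_of_notMem hi]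

theorem killed_sum {ι : Type*} (U : Set ℤ) (s : Finset ι) (f : ι → ℤ → ℝ≥0∞) (i : ℤ) :
    killed M ω U (fun e => ∑ a ∈ s, f a e) i = ∑ a ∈ s, killed M ω U (f a) i := by
  unfold killed
  by_cases hi : i ∈ U
  · simp only [Set.indicator_of_mem hi, avg]
    rw [Finset.sum_comm]
    exact Finset.sum_congr rfl fun e _ => Finset.mul_sum _ _ _
  · simp [Set.indicator_of_notMem hi]

theorem killed_const_mul (U : Set ℤ) (c : ℝ≥0∞) (f : ℤ → ℝ≥0∞) (i : ℤ) :
    killed M ω U (fun e => c * f e) i = c * killed M ω U f i := by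
  unfold killed
  by_cases hi : i ∈ U
  · simp only [Set.indicator_of_mem hi, avg, Finset.mul_sum]
    exact Finset.sum_congr rfl fun e _ => mul_left_comm _ _ _
  · simp [Set.indicator_of_notMem hi]

theorem iterate_killed_sum {ι : Type*} (U : Set ℤ) (s : Finset ι) (f : ι → ℤ → ℝ≥0∞) (n : ℕ)
    (i : ℤ) : (killed M ω U)^[n] (fun e => ∑ a ∈ s, f a e) i =
      ∑ a ∈ s, (killed M ω U)^[n] (f a) i := by
  induction n generalizing i with
  | zero => rfl
  | succ n ih =>
    simp only [Function.iterate_succ_apply']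
    rw [funext ih, killed_sum]

theorem iterate_killed_const_mul (U : Set ℤ) (c : ℝ≥0∞) (f : ℤ → ℝ≥0∞) (n : ℕ) (i : ℤ) :
    (killed M ω U)^[n] (fun e => c * f e) i = c * (killed M ω U)^[n] f i := by
  induction n generalizing i with
  | zero => rfl
  | succ n ih =>
    simp only [Function.iterate_succ_apply']
    rw [funext ih, killed_const_mul]

theorem pot_eq (U : Set ℤ) (f : ℤ → ℝ≥0∞) (i : ℤ) :
    pot M ω U f i = f i + killed M ω U (pot M ω U f) i := by
  have : killed M ω U (pot M ω U f) i = ∑' n : ℕ, (killed M ω U)^[n + 1] f i := by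
    simp only [Function.iterate_succ_apply']
    exact killed_tsum U _ i
  rw [this, pot, tsum_eq_zero_add' ENNReal.summable, Function.iterate_zero, id]

/-- The potential is the least nonnegative solution of this inequality: each partial sum stays below
`g` because the killed operator is monotone. No finiteness is assumed, so this is a way to prove
that a potential is finite. -/
theorem pot_le_of_superharmonic {U : Set ℤ} {f g : ℤ → ℝ≥0∞}
    (h : ∀ i, f i + killed M ω U g i ≤ g i) (i : ℤ) : pot M ω U f i ≤ g i := by
  refine ENNReal.tsum_le_of_sum_range_le fun n => ?_
  induction n generalizing i with
  | zero => simp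
  | succ n ih =>
    rw [Finset.sum_range_succ']
    simp only [Function.iterate_succ_apply', Function.iterate_zero, id]
    rw [← killed_sum, add_comm]
    refine (add_le_add_right ?_ _).trans (h i)
    exact killed_mono subset_rfl ih i

theorem sum_pot (U : Set ℤ) {ι : Type*} (s : Finset ι) (f : ι → ℤ → ℝ≥0∞) (i : ℤ) :
    ∑ a ∈ s, pot M ω U (f a) i = pot M ω U (fun e => ∑ a ∈ s, f a e) i := by
  simp only [pot, iterate_killed_sum]
  exact (Summable.tsum_finsetSum fun _ _ => ENNReal.summable).symm

theorem pot_const_mul (U : Set ℤ) (c : ℝ≥0∞) (f : ℤ → ℝ≥0∞) (i : ℤ) :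
    pot M ω U (fun e => c * f e) i = c * pot M ω U f i := by
  simp only [pot, iterate_killed_const_mul]
  exact ENNReal.tsum_mul_left

/-- The walk is killed only after it has left `U`, so the exit point is still counted. This matches
the sums up to and including `T_U` in Kalikow's quotient. -/
theorem pot_of_notMem {U : Set ℤ} {i : ℤ} (hi : i ∉ U) (f : ℤ → ℝ≥0∞) :
    pot M ω U f i = f i := by
  rw [pot_eq]; simp [killed, hi]

theorem pot_of_mem {U : Set ℤ} {i : ℤ} (hi : i ∈ U) (f : ℤ → ℝ≥0∞) :
    pot M ω U f i = f i + avg M ω (pot M ω U f) i := by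
  rw [pot_eq]; simp [killed, hi]

theorem sum_delta (s : Finset ℤ) : (fun e => ∑ j ∈ s, delta j e) = (s : Set ℤ).indicator 1 := by
  funext e
  by_cases h : e ∈ s
  · rw [Finset.sum_eq_single e]
    · simp [delta, h]
    · intro b _ hb; simp [delta, hb.symm]
    · exact fun h' => absurd h h'
  · rw [Finset.sum_eq_zero]
    · simp [h]
    · intro b hb
      have : e ≠ b := fun h' => h (h' ▸ hb)
      simp [delta, this]

/-- The visits to the sites of `s` add up to at most the time spent in `U`; bounds on exit times
thereby become bounds on Green functions. -/
theorem sum_pot_delta_le {U : Set ℤ} {s : Finset ℤ} (hs : (s : Set ℤ) ⊆ U) (i : ℤ) :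
    ∑ j ∈ s, pot M ω U (delta j) i ≤ pot M ω U (U.indicator 1) i := by
  rw [sum_pot, sum_delta]
  exact pot_mono subset_rfl (Set.indicator_le_indicator_of_subset hs (fun _ => zero_le)) i

theorem measurable_iterate_killed (U : Set ℤ) (f : ℤ → ℝ≥0∞) (n : ℕ) (i : ℤ) :
    Measurable fun ω : Env => (killed M ω U)^[n] f i := by
  induction n generalizing i with
  | zero => exact measurable_const
  | succ n ih =>
    simp only [Function.iterate_succ_apply', killed]
    by_cases hi : i ∈ U
    · simp only [Set.indicator_of_mem hi, avg]
      exact Finset.measurable_sum _ fun e _ => (measurable_entry i e).ennreal_ofReal.mul (ih e)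
    · simp [Set.indicator_of_notMem hi]

theorem measurable_pot (U : Set ℤ) (f : ℤ → ℝ≥0∞) (i : ℤ) :
    Measurable fun ω : Env => pot M ω U f i :=
  Measurable.tsum fun n => measurable_iterate_killed U f n i

theorem iterate_killed_shift (k : ℤ) (U : Set ℤ) (f : ℤ → ℝ≥0∞) (n : ℕ) (i : ℤ) :
    (killed M (shift k ω) U)^[n] f i =
      (killed M ω ((· - k) ⁻¹' U))^[n] (fun e => f (e - k)) (k + i) := by
  induction n generalizing i with
  | zero => simp
  | succ n ih =>
    simp only [Function.iterate_succ_apply', killed]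
    by_cases hi : i ∈ U
    · have hi' : k + i ∈ (· - k) ⁻¹' U := by simpa using hi
      rw [Set.indicator_of_mem hi, Set.indicator_of_mem hi']
      simp only [avg]
      have : Finset.Icc (k + i - M) (k + i + M) =
          (Finset.Icc (i - M) (i + M)).map (addLeftEmbedding k) := by
        rw [Finset.map_add_left_Icc]; congr 1 <;> ring
      rw [this, Finset.sum_map]
      refine Finset.sum_congr rfl fun e _ => ?_
      rw [ih e]
      rfl
    · have hi' : k + i ∉ (· - k) ⁻¹' U := by simpa using hi
      rw [Set.indicator_of_notMem hi, Set.indicator_of_notMem hi']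

theorem pot_shift (k : ℤ) (U : Set ℤ) (f : ℤ → ℝ≥0∞) (i : ℤ) :
    pot M (shift k ω) U f i = pot M ω ((· - k) ⁻¹' U) (fun e => f (e - k)) (k + i) :=
  tsum_congr fun n => iterate_killed_shift k U f n i

theorem delta_sub (j k : ℤ) : (fun e => delta j (e - k)) = delta (k + j) := by
  funext e
  simp only [delta, Set.indicator_apply, Set.mem_singleton_iff, sub_eq_iff_eq_add, add_comm]
  rfl

namespace Regular

theorem mem_Icc (hω : Regular M κ ω) {i e : ℤ} (he : e ∉ Finset.Icc (i - (M : ℤ)) (i + M)) :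
    ω.1 i e = 0 := by
  apply hω.range
  rw [Finset.mem_Icc] at he
  by_contra! h
  exact he (by rw [abs_le] at h; constructor <;> linarith)

theorem sum_row (hω : Regular M κ ω) (i : ℤ) :
    ∑ e ∈ Finset.Icc (i - (M : ℤ)) (i + M), ω.1 i e = 1 :=
  (hasSum_sum_of_ne_finset_zero fun _ he => hω.mem_Icc he).unique (ω.2.2 i)

theorem ravg_const (hω : Regular M κ ω) (c : ℝ) (i : ℤ) : ravg M ω (fun _ => c) i = c := by
  rw [ravg, ← Finset.sum_mul, hω.sum_row, one_mul]

theorem tsum_row (hω : Regular M κ ω) (i : ℤ) (f : ℤ → ℝ≥0∞) :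
    ∑' e, ENNReal.ofReal (ω.1 i e) * f e = avg M ω f i :=
  tsum_eq_sum fun e he => by rw [hω.mem_Icc he]; simp

theorem shift (hω : Regular M κ ω) (k : ℤ) : Regular M κ (shift k ω) :=
  ⟨hω.pos, fun i j h => hω.range _ _ (by simpa using h),
    fun i j h => hω.elliptic _ _ (by simpa using h)⟩

end Regular

theorem avg_ofReal {h : ℤ → ℝ} {i : ℤ} (hh : ∀ e ∈ Finset.Icc (i - (M : ℤ)) (i + M), 0 ≤ h e) :
    avg M ω (fun e => ENNReal.ofReal (h e)) i = ENNReal.ofReal (ravg M ω h i) := by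
  rw [avg, ravg, ENNReal.ofReal_sum_of_nonneg fun e he => mul_nonneg (ω.2.1 i e).1 (hh e he)]
  exact Finset.sum_congr rfl fun e _ => (ENNReal.ofReal_mul (ω.2.1 i e).1).symm

theorem toReal_avg {f : ℤ → ℝ≥0∞} (hf : ∀ e, f e ≠ ∞) (i : ℤ) :
    (avg M ω f i).toReal = ravg M ω (fun e => (f e).toReal) i := by
  rw [avg, ravg, ENNReal.toReal_sum fun e _ => ENNReal.mul_ne_top ENNReal.ofReal_ne_top (hf e)]
  exact Finset.sum_congr rfl fun e _ => by
    rw [ENNReal.toReal_mul, ENNReal.toReal_ofReal (ω.2.1 i e).1]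

theorem ravg_mono {h h' : ℤ → ℝ} {i : ℤ}
    (hh : ∀ e ∈ Finset.Icc (i - (M : ℤ)) (i + M), h e ≤ h' e) : ravg M ω h i ≤ ravg M ω h' i :=
  Finset.sum_le_sum fun e he => mul_le_mul_of_nonneg_left (hh e he) (ω.2.1 i e).1

theorem ravg_add (h h' : ℤ → ℝ) (i : ℤ) :
    ravg M ω (fun e => h e + h' e) i = ravg M ω h i + ravg M ω h' i := by
  simp [ravg, mul_add, Finset.sum_add_distrib]

theorem ravg_sub (h h' : ℤ → ℝ) (i : ℤ) :
    ravg M ω (fun e => h e - h' e) i = ravg M ω h i - ravg M ω h' i := by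
  simp [ravg, mul_sub, Finset.sum_sub_distrib]

theorem ravg_const_mul (c : ℝ) (h : ℤ → ℝ) (i : ℤ) :
    ravg M ω (fun e => c * h e) i = c * ravg M ω h i := by
  simp only [ravg, Finset.mul_sum]
  exact Finset.sum_congr rfl fun e _ => mul_left_comm _ _ _

/-- The left side is the probability that the walk stays in `U` up to time `n`. -/
theorem Regular.survival_le_one (hω : Regular M κ ω) (U : Set ℤ) (n : ℕ) (i : ℤ) :
    (killed M ω U)^[n] (U.indicator 1) i ≤ 1 := by
  induction n generalizing i with
  | zero => exact Set.indicator_le_self' (fun _ _ => zero_le) i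
  | succ n ih =>
    rw [Function.iterate_succ_apply']
    refine (Set.indicator_le_self' (fun _ _ => zero_le) i).trans ?_
    refine (avg_mono (g := fun _ => ENNReal.ofReal 1) (fun e => by simpa using ih e) i).trans ?_
    rw [avg_ofReal fun _ _ => zero_le_one, hω.ravg_const, ENNReal.ofReal_one]

theorem sum_range_succ_iterate_killed (U : Set ℤ) (f : ℤ → ℝ≥0∞) (n : ℕ) (i : ℤ) :
    ∑ m ∈ Finset.range (n + 1), (killed M ω U)^[m] f i =
      f i + killed M ω U (fun e => ∑ m ∈ Finset.range n, (killed M ω U)^[m] f e) i := by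
  rw [Finset.sum_range_succ', killed_sum, add_comm]
  simp only [Function.iterate_succ_apply', Function.iterate_zero, id]

theorem Regular.avg_const (hω : Regular M κ ω) (c : ℝ≥0∞) (i : ℤ) :
    avg M ω (fun _ => c) i = c := by
  rw [avg, ← Finset.sum_mul, ← ENNReal.ofReal_sum_of_nonneg fun _ _ => (ω.2.1 i _).1, hω.sum_row,
    ENNReal.ofReal_one, one_mul]

/-- The Green function is largest on the diagonal. -/
theorem Regular.pot_delta_le (hω : Regular M κ ω) (U : Set ℤ) (i j : ℤ) :
    pot M ω U (delta j) i ≤ pot M ω U (delta j) j := by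
  -- Truncation replaces a decomposition at the hitting time of `j`: for `i ≠ j` the sum of `n + 1`
  -- terms at `i` is at most an average of sums of `n` terms, each bounded by the sum at `j`.
  refine ENNReal.tsum_le_of_sum_range_le fun n => le_trans ?_ (ENNReal.sum_le_tsum (Finset.range n))
  induction n generalizing i with
  | zero => simp
  | succ n ih =>
    by_cases hij : i = j
    · rw [hij]
    refine le_trans ?_ (Finset.sum_le_sum_of_subset (Finset.range_mono n.le_succ))
    rw [sum_range_succ_iterate_killed]
    have h0 : delta j i = 0 := by simp [delta, hij]
    rw [h0, zero_add]
    refine (Set.indicator_le_self' (fun _ _ => zero_le) i).trans ?_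
    exact (avg_mono (fun e => ih e) i).trans_eq (hω.avg_const _ i)

/-- The minimum principle: a function that is bounded below, superharmonic on a set `U` from which
the walk escapes, and nonnegative on the boundary of `U`, is nonnegative on `U`. -/
theorem Regular.nonneg_of_superharmonic (hω : Regular M κ ω) {U : Set ℤ} {h : ℤ → ℝ} {B : ℝ}
    (hB : ∀ i ∈ U, -B ≤ h i) (hsup : ∀ i ∈ U, ravg M ω h i ≤ h i)
    (hbd : ∀ i ∈ U, ∀ e ∉ U, |e - i| ≤ (M : ℤ) → 0 ≤ h e)
    (hesc : ∀ i ∈ U, Tendsto (fun n => (killed M ω U)^[n] (U.indicator 1) i) atTop (𝓝 0)) :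
    ∀ i ∈ U, 0 ≤ h i := by
  -- This stands in for optional stopping at time `n`: `h` can be negative only through the paths
  -- that have not yet left `U`, and these cost at most `B` times the survival probability.
  have key : ∀ n : ℕ, ∀ i ∈ U, 0 ≤ h i + B * ((killed M ω U)^[n] (U.indicator 1) i).toReal := by
    intro n
    induction n with
    | zero => intro i hi; simp [hi]; linarith [hB i hi]
    | succ n ih =>
      intro i hi
      rw [Function.iterate_succ_apply', killed, Set.indicator_of_mem hi,
        toReal_avg fun e => ((hω.survival_le_one U n e).trans_lt ENNReal.one_lt_top).ne,
        ← ravg_const_mul]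
      refine le_trans ?_ (add_le_add_left (hsup i hi) _)
      rw [← ravg_add]
      refine (hω.ravg_const 0 i).symm.le.trans (ravg_mono fun e he => ?_)
      by_cases heU : e ∈ U
      · exact ih e heU
      · have h0 : (killed M ω U)^[n] (U.indicator 1) e = 0 := by
          cases n with
          | zero => simp [heU]
          | succ n => rw [Function.iterate_succ_apply']; simp [killed, heU]
        rw [h0]
        simp only [ENNReal.toReal_zero, mul_zero, add_zero]
        refine hbd i hi e heU ?_
        rw [Finset.mem_Icc] at he
        rw [abs_le]; constructor <;> linarith [he.1, he.2]
  intro i hi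
  have h1 : Tendsto (fun n => h i + B * ((killed M ω U)^[n] (U.indicator 1) i).toReal) atTop
      (𝓝 (h i + B * 0)) :=
    (((ENNReal.tendsto_toReal ENNReal.zero_ne_top).comp (hesc i hi)).const_mul B).const_add (h i)
  simpa using ge_of_tendsto' h1 fun n => key n i hi

theorem tendsto_of_pot_ne_top {U : Set ℤ} {f : ℤ → ℝ≥0∞} {i : ℤ} (h : pot M ω U f i ≠ ∞) :
    Tendsto (fun n => (killed M ω U)^[n] f i) atTop (𝓝 0) :=
  ENNReal.tendsto_atTop_zero_of_tsum_ne_top h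

/-! ### Expected visits and Kalikow's quotient. -/

theorem measurableSet_visit (U : Set ℤ) (n : ℕ) (j : ℤ) :
    MeasurableSet {X : ℕ → ℤ | (∀ k < n, X k ∈ U) ∧ X n = j} := by
  have : {X : ℕ → ℤ | (∀ k < n, X k ∈ U) ∧ X n = j} =
      (⋂ k ∈ Finset.range n, (fun X : ℕ → ℤ => X k) ⁻¹' U) ∩ (fun X => X n) ⁻¹' {j} := by
    ext; simp
  rw [this]
  exact (Finset.measurableSet_biInter _ fun k _ => measurable_pi_apply k .of_discrete).inter
    (measurable_pi_apply n (measurableSet_singleton _))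

/-- The iterates of the killed operator are the transition probabilities of the killed walk. -/
theorem Regular.quenchedLaw_visit (hω : Regular M κ ω) (U : Set ℤ) (n : ℕ) (i j : ℤ) :
    quenchedLaw ω i {X | (∀ k < n, X k ∈ U) ∧ X n = j} = (killed M ω U)^[n] (delta j) i := by
  induction n generalizing i with
  | zero =>
    have := quenchedLaw_cylinder ω i 0 fun _ => j
    simp only [Nat.le_zero, forall_eq, Finset.range_zero, Finset.prod_empty, mul_one] at this
    simp only [not_lt_zero, false_imp_iff, implies_true, true_and, Function.iterate_zero, id]
    rw [this]
    simp [delta, Set.indicator_apply, eq_comm]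
  | succ n ih =>
    rw [quenchedLaw_apply ω i (measurableSet_visit U (n + 1) j), Function.iterate_succ_apply',
      killed]
    have hpre : consPath i ⁻¹' {X | (∀ k < n + 1, X k ∈ U) ∧ X (n + 1) = j} =
        {_Y | i ∈ U} ∩ {Y | (∀ k < n, Y k ∈ U) ∧ Y n = j} := by
      ext Y
      simp only [Set.mem_preimage, Set.mem_ofPred_eq, Set.mem_inter_iff]
      constructor
      · rintro ⟨h1, h2⟩
        exact ⟨h1 0 n.succ_pos, fun k hk => h1 (k + 1) (by omega), h2⟩
      · rintro ⟨h0, h1, h2⟩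
        refine ⟨fun k hk => ?_, h2⟩
        cases k with
        | zero => exact h0
        | succ k => exact h1 k (by omega)
    simp_rw [hpre]
    by_cases hi : i ∈ U
    · simp only [hi, Set.ofPred_true, Set.univ_inter, Set.indicator_of_mem hi, ih]
      exact hω.tsum_row i _
    · simp [hi]

theorem Regular.green_eq_pot (hω : Regular M κ ω) (i j : ℤ) :
    green i j ω = pot M ω Set.univ (delta j) i := by
  refine tsum_congr fun n => ?_
  rw [← hω.quenchedLaw_visit]
  simp

/-- The number of visits to `x` up to the exit time of `U`. -/
noncomputable def visits (U : Finset ℤ) (x : ℤ) (X : ℕ → ℤ) : ℝ≥0∞ :=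
  ∑' j : ℕ, {X : ℕ → ℤ | (∀ k < j, X k ∈ (U : Set ℤ)) ∧ X j = x}.indicator 1 X

theorem measurable_visits (U : Finset ℤ) (x : ℤ) : Measurable (visits U x) :=
  Measurable.tsum fun j => measurable_one.indicator (measurableSet_visit U j x)

theorem Regular.lintegral_visits (hω : Regular M κ ω) (U : Finset ℤ) (x i : ℤ) :
    ∫⁻ X, visits U x X ∂quenchedLaw ω i = pot M ω U (delta x) i := by
  unfold visits
  rw [lintegral_tsum fun j => (measurable_one.indicator (measurableSet_visit U j x)).aemeasurable]
  refine tsum_congr fun j => ?_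
  rw [lintegral_indicator_one (measurableSet_visit _ _ _), hω.quenchedLaw_visit]

theorem le_exitTime_iff (U : Finset ℤ) (X : ℕ → ℤ) (j : ℕ) :
    (j : ℕ∞) ≤ exitTime U X ↔ ∀ k < j, X k ∈ U := by
  unfold exitTime
  rw [le_sInf_iff]
  constructor
  · intro h k hk
    by_contra hX
    have := h k ⟨k, hX, rfl⟩
    exact absurd (Nat.cast_le.1 this) (by omega)
  · rintro h _ ⟨k, hk, rfl⟩
    rw [Nat.cast_le]
    by_contra hlt
    exact hk (h k (by omega))

open Classical in
-- When `X_j = x`, the summand of Kalikow's numerator depends on the environment only, so this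
-- serves the numerator with `c` the drift at `x` and the denominator with `c = 1`. For infinitely
-- many visits both sides are `0`.
theorem tsum_visits (U : Finset ℤ) (x : ℤ) (X : ℕ → ℤ) (c : ℝ) :
    (∑' j : ℕ, if (j : ℕ∞) ≤ exitTime U X ∧ X j = x then c else 0) =
      c * (visits U x X).toReal := by
  have hne : ∀ j : ℕ,
      {X : ℕ → ℤ | (∀ k < j, X k ∈ (U : Set ℤ)) ∧ X j = x}.indicator (1 : (ℕ → ℤ) → ℝ≥0∞) X ≠ ∞ := by
    intro j
    rw [Set.indicator_apply]
    split_ifs <;> simp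
  rw [visits, ENNReal.tsum_toReal_eq hne, ← tsum_mul_left]
  refine tsum_congr fun j => ?_
  simp only [Set.indicator_apply, le_exitTime_iff, Set.mem_ofPred_eq, Finset.mem_coe]
  split_ifs <;> simp

theorem Regular.drift_shift (hω : Regular M κ ω) (x : ℤ) :
    drift (RWRE.shift x ω) = ravg M ω (fun e => (e : ℝ) - x) x := by
  unfold drift
  rw [tsum_eq_sum (s := Finset.Icc (-(M : ℤ)) M)]
  · have : Finset.Icc (x - (M : ℤ)) (x + M) =
        (Finset.Icc (-(M : ℤ)) M).map (addLeftEmbedding x) := by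
      rw [Finset.map_add_left_Icc]; rfl
    rw [ravg, this, Finset.sum_map]
    refine Finset.sum_congr rfl fun e _ => ?_
    simp [RWRE.shift, mul_comm]
  · intro e he
    have := (hω.shift x).mem_Icc (i := 0) (e := e) (by simpa using he)
    simp [this]

theorem Regular.abs_drift_shift_le (hω : Regular M κ ω) (x : ℤ) :
    |drift (RWRE.shift x ω)| ≤ M := by
  rw [hω.drift_shift, abs_le]
  constructor
  · rw [← hω.ravg_const (-(M : ℝ)) x]
    refine ravg_mono fun e he => ?_
    rw [Finset.mem_Icc] at he
    have : ((x - M : ℤ) : ℝ) ≤ e := by exact_mod_cast he.1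
    push_cast at this
    linarith
  · rw [← hω.ravg_const (M : ℝ) x]
    refine ravg_mono fun e he => ?_
    rw [Finset.mem_Icc] at he
    have : (e : ℝ) ≤ ((x + M : ℤ) : ℝ) := by exact_mod_cast he.2
    push_cast at this
    linarith

theorem measurable_ravg (h : ℤ → ℝ) (i : ℤ) : Measurable fun ω : Env => ravg M ω h i :=
  Finset.measurable_sum _ fun e _ => (measurable_entry i e).mul_const _

theorem aemeasurable_drift_shift {P : Measure Env} (h : ∀ᵐ ω ∂P, Regular M κ ω) (x : ℤ) :
    AEMeasurable (fun ω => drift (shift x ω)) P :=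
  (measurable_ravg (M := M) (fun e => (e : ℝ) - x) x).aemeasurable.congr <| by
    filter_upwards [h] with ω hω
    exact (hω.drift_shift x).symm

/-- The quotient in Kalikow's condition, through the Green function of the killed walk. -/
theorem kalikowQuotient_eq {P : Measure Env} [IsProbabilityMeasure P]
    (h : ∀ᵐ ω ∂P, Regular M κ ω) (U : Finset ℤ) (x : ℤ)
    (hfin : ∫⁻ ω, pot M ω U (delta x) 0 ∂P ≠ ∞) :
    kalikowQuotient P U x =
      (∫ ω, drift (shift x ω) * (pot M ω U (delta x) 0).toReal ∂P) /
        ∫ ω, (pot M ω U (delta x) 0).toReal ∂P := by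
  have hfin' : ∀ᵐ ω ∂P, pot M ω U (delta x) 0 < ∞ :=
    ae_lt_top (measurable_pot _ _ _) hfin
  have hv : Measurable fun q : Env × (ℕ → ℤ) => visits U x q.2 :=
    (measurable_visits U x).comp measurable_snd
  have hlin : ∫⁻ q, visits U x q.2 ∂annealedLaw P 0 = ∫⁻ ω, pot M ω U (delta x) 0 ∂P := by
    rw [annealedLaw, Measure.lintegral_compProd hv]
    refine lintegral_congr_ae ?_
    filter_upwards [h] with ω hω
    exact hω.lintegral_visits U x 0
  have hint : Integrable (fun q : Env × (ℕ → ℤ) => (visits U x q.2).toReal) (annealedLaw P 0) :=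
    integrable_toReal_of_lintegral_ne_top hv.aemeasurable (hlin ▸ hfin)
  have hinner : ∀ᵐ ω ∂P, ∫ X, (visits U x X).toReal ∂quenchedLaw ω 0 =
      (pot M ω U (delta x) 0).toReal := by
    filter_upwards [h, hfin'] with ω hω hf
    rw [integral_toReal (measurable_visits U x).aemeasurable, hω.lintegral_visits]
    exact ae_lt_top (measurable_visits U x) (by rw [hω.lintegral_visits]; exact hf.ne)
  have hfst : Measure.QuasiMeasurePreserving (Prod.fst : Env × (ℕ → ℤ) → Env)
      (annealedLaw P 0) P := ⟨measurable_fst, by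
    have : (annealedLaw P 0).map Prod.fst = P := Measure.fst_compProd P (quenchedKernel 0)
    rw [this]⟩
  unfold kalikowQuotient
  congr 1
  · have h1 : ∀ q : Env × (ℕ → ℤ), (∑' j : ℕ, if (j : ℕ∞) ≤ exitTime U q.2 ∧ q.2 j = x then
        drift (shift (q.2 j) q.1) else 0) =
        drift (shift x q.1) * (visits U x q.2).toReal := by
      intro q
      rw [← tsum_visits]
      refine tsum_congr fun j => ?_
      split_ifs with hj
      · rw [hj.2]
      · rfl
    simp_rw [h1]
    have hint' : Integrable (fun q : Env × (ℕ → ℤ) =>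
        drift (shift x q.1) * (visits U x q.2).toReal) (annealedLaw P 0) := by
      refine hint.bdd_mul (c := M)
        ((aemeasurable_drift_shift h x).comp_quasiMeasurePreserving hfst).aestronglyMeasurable ?_
      filter_upwards [hfst.ae h] with q hq
      exact hq.abs_drift_shift_le x
    rw [annealedLaw, Measure.integral_compProd hint']
    refine integral_congr_ae ?_
    filter_upwards [hinner] with ω hω
    rw [← hω, ← integral_const_mul]
    rfl
  · simp_rw [tsum_visits, one_mul]
    rw [annealedLaw, Measure.integral_compProd hint]
    exact integral_congr_ae hinner

/-! ### Mean exit times of intervals and half-lines. -/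

/-- The walk leaves a finite interval in a time whose mean is bounded uniformly in the
environment. -/
theorem exists_pot_Icc_le (hM : 1 ≤ M) (hκ : 0 < κ) (L N : ℕ) : ∃ B : ℝ≥0∞, B ≠ ∞ ∧
    ∀ ω, Regular M κ ω → ∀ i, pot M ω (Set.Icc (-(L : ℤ)) N) ((Set.Icc (-(L : ℤ)) N).indicator 1) i
      ≤ B := by
  -- The barrier is `h i = B - lam ^ p i`. Since `κ * lam ≥ 2`, a step to the right alone makes the
  -- average of `lam ^ p` at least `2 * lam ^ p i ≥ lam ^ p i + 1`, so `h` loses at least `1` per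
  -- step. `B` is the value of `lam ^ p` at `N + M`, the furthest reachable site, which keeps `h`
  -- nonnegative.
  set lam : ℝ := 2 / κ + 1 with hlam
  have hl : 1 ≤ lam := by rw [hlam]; have := div_pos two_pos hκ; linarith
  have hkl : 2 ≤ κ * lam := by
    rw [hlam, mul_add, mul_div_cancel₀ _ hκ.ne']; linarith
  set p : ℤ → ℕ := fun i => (i + L + M).toNat with hp
  set B : ℝ := lam ^ (L + N + 2 * M) with hB
  have hpB : ∀ i : ℤ, i ≤ N + M → lam ^ p i ≤ B := fun i hi =>
    pow_le_pow_right₀ hl (by simp only [hp]; omega)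
  refine ⟨ENNReal.ofReal B, ENNReal.ofReal_ne_top, fun ω hω i => ?_⟩
  set U := Set.Icc (-(L : ℤ)) N
  set h : ℤ → ℝ := fun i => B - lam ^ p i with hh
  have hle : ∀ i, pot M ω U (U.indicator 1) i ≤ ENNReal.ofReal (h i) := by
    refine pot_le_of_superharmonic (g := fun i => ENNReal.ofReal (h i)) (fun i => ?_)
    by_cases hi : i ∈ U
    · rw [killed, Set.indicator_of_mem hi, Set.indicator_of_mem hi, Pi.one_apply, avg_ofReal,
        ← ENNReal.ofReal_one]
      · have hle : ravg M ω h i ≤ h i - 1 := by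
          have h1 : ravg M ω h i = B - ravg M ω (fun e => lam ^ p e) i := by
            rw [hh, ravg_sub, hω.ravg_const]
          have h2 : ω.1 i (i + 1) * lam ^ p (i + 1) ≤ ravg M ω (fun e => lam ^ p e) i := by
            refine Finset.single_le_sum (f := fun e => ω.1 i e * lam ^ p e) (fun e _ => ?_) ?_
            · exact mul_nonneg (ω.2.1 i e).1 (by positivity)
            · rw [Finset.mem_Icc]; omega
          have h3 : κ < ω.1 i (i + 1) := hω.elliptic _ _ (by
            rw [show i - (i + 1) = -1 by ring]; simp; omega)
          have h4 : p (i + 1) = p i + 1 := by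
            have := hi.1
            simp only [hp]; omega
          have h5 : 1 ≤ lam ^ p i := one_le_pow₀ hl
          have h6 : κ * lam ^ p (i + 1) ≤ ω.1 i (i + 1) * lam ^ p (i + 1) :=
            mul_le_mul_of_nonneg_right h3.le (by positivity)
          rw [h4, pow_succ] at h6 h2
          simp only [hh] at *
          nlinarith
        have h0 : 0 ≤ ravg M ω h i := by
          rw [← hω.ravg_const 0 i]
          refine ravg_mono fun e he => ?_
          have := hpB e (by have := hi.2; rw [Finset.mem_Icc] at he; omega)
          simp only [hh]; linarith
        rw [← ENNReal.ofReal_add zero_le_one h0]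
        exact ENNReal.ofReal_le_ofReal (by linarith)
      · intro e he
        have := hpB e (by have := hi.2; rw [Finset.mem_Icc] at he; omega)
        simp only [hh]; linarith
    · simp [killed, hi]
  refine (hle i).trans (ENNReal.ofReal_le_ofReal ?_)
  have : 0 ≤ lam ^ p i := by positivity
  simp only [hh]; linarith

theorem delta_self (j : ℤ) : delta j j = 1 := by simp [delta]

theorem delta_of_ne {j e : ℤ} (h : e ≠ j) : delta j e = 0 := by simp [delta, h]

theorem delta_ne_top (j e : ℤ) : delta j e ≠ ∞ := by
  by_cases h : e = j
  · simp [h, delta_self]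
  · simp [delta_of_ne h]

/-- The walk at its exit from `[-L, N]` is at most at `N + M`, so that its accumulated drift is at
most `N + M`. -/
theorem Regular.sum_pot_mul_drift_le (hM : 1 ≤ M) (hω : Regular M κ ω) (L N : ℕ) :
    ∑ x ∈ Finset.Icc (-(L : ℤ)) N,
      drift (RWRE.shift x ω) * (pot M ω (Finset.Icc (-(L : ℤ)) (N : ℤ)) (delta x) 0).toReal ≤
        N + M := by
  set U := Finset.Icc (-(L : ℤ)) (N : ℤ) with hU
  obtain ⟨B, hB, hpot⟩ := exists_pot_Icc_le hM hω.pos L N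
  have hpotU : ∀ i, pot M ω U ((U : Set ℤ).indicator 1) i ≠ ∞ := fun i =>
    ((by rw [hU, Finset.coe_Icc]; exact hpot ω hω i : pot M ω U _ i ≤ B).trans_lt hB.lt_top).ne
  have hfin : ∀ x ∈ U, ∀ i, pot M ω U (delta x) i ≠ ∞ := fun x hx i =>
    ((Finset.single_le_sum (f := fun x => pot M ω U (delta x) i) (fun _ _ => zero_le) hx).trans
      (sum_pot_delta_le subset_rfl i) |>.trans_lt (hpotU i).lt_top).ne
  set v : ℤ → ℝ := fun i => ∑ x ∈ U, drift (RWRE.shift x ω) * (pot M ω U (delta x) i).toReal with hv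
  set h : ℤ → ℝ := fun i => ((N : ℝ) + M - i) - v i with hh
  have hvU : ∀ i ∈ U, v i = drift (RWRE.shift i ω) + ravg M ω v i := by
    intro i hi
    have h1 : ravg M ω v i = ∑ x ∈ U, drift (RWRE.shift x ω) *
        ravg M ω (fun e => (pot M ω U (delta x) e).toReal) i := by
      simp only [ravg, hv, Finset.mul_sum]
      rw [Finset.sum_comm]
      exact Finset.sum_congr rfl fun _ _ => Finset.sum_congr rfl fun _ _ => mul_left_comm _ _ _
    have h2 : ∀ x ∈ U, (pot M ω U (delta x) i).toReal =
        (delta x i).toReal + ravg M ω (fun e => (pot M ω U (delta x) e).toReal) i := by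
      intro x hx
      rw [pot_of_mem (Finset.mem_coe.2 hi), ENNReal.toReal_add (delta_ne_top x i),
        toReal_avg (hfin x hx)]
      have := hfin x hx i
      rw [pot_of_mem (Finset.mem_coe.2 hi)] at this
      exact (ENNReal.add_ne_top.1 this).2
    rw [h1, hv]
    simp only
    rw [Finset.sum_congr rfl fun x hx => by rw [h2 x hx, mul_add], Finset.sum_add_distrib]
    congr 1
    rw [Finset.sum_eq_single i]
    · simp [delta_self]
    · intro x _ hx; simp [delta_of_ne hx.symm]
    · intro hi'; exact absurd hi hi'
  have hmin := hω.nonneg_of_superharmonic (U := (U : Set ℤ)) (h := h) (B := ∑ i ∈ U, |h i|)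
    (fun i hi => ?_) (fun i hi => ?_) (fun i hi e he hei => ?_)
    (fun i _ => tendsto_of_pot_ne_top (hpotU i)) 0 (by simp [hU])
  · simp only [hh, hv, Int.cast_zero] at hmin
    linarith
  · have := Finset.single_le_sum (f := fun i => |h i|) (fun _ _ => abs_nonneg _)
      (Finset.mem_coe.1 hi)
    have h' := neg_abs_le (h i)
    linarith
  · have h1 : ravg M ω h i = ravg M ω (fun e => (N : ℝ) + M - e) i - ravg M ω v i :=
      ravg_sub _ _ i
    have h2 : ravg M ω (fun e => (N : ℝ) + M - e) i = (N + M - i) - drift (RWRE.shift i ω) := by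
      rw [hω.drift_shift, ← hω.ravg_const ((N : ℝ) + M - i) i, ← ravg_sub]
      congr 1
      funext e
      ring
    rw [h1, h2]
    simp only [hh]
    rw [hvU i (Finset.mem_coe.1 hi)]
    linarith
  · have hve : v e = 0 := by
      refine Finset.sum_eq_zero fun x hx => ?_
      rw [pot_of_notMem he, delta_of_ne (fun h : e = x => he (by rw [h]; exact hx))]
      simp
    have hi' := (Finset.mem_Icc.1 (Finset.mem_coe.1 hi)).2
    rw [abs_le] at hei
    have h1 : e ≤ (N : ℤ) + M := by linarith [hei.2]
    have h2 : (e : ℝ) ≤ N + M := by exact_mod_cast h1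
    simp only [hh, hve]
    linarith

theorem mConnected_Icc (hM : 1 ≤ M) (L N : ℕ) : MConnected M (Finset.Icc (-(L : ℤ)) N) := by
  refine ⟨(List.range (N + L + 1)).map fun k : ℕ => (k : ℤ) - L, ?_, fun z => ?_⟩
  · rw [List.isChain_map, List.isChain_range]
    intro m _
    simp; omega
  · simp only [List.mem_map, List.mem_range, Finset.mem_Icc]
    constructor
    · rintro ⟨k, hk, rfl⟩; omega
    · rintro ⟨h1, h2⟩
      exact ⟨(z + L).toNat, by omega, by omega⟩

/-- The hypotheses on the environment, with the constants made explicit. -/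
structure Setting (P : Measure Env) (M : ℕ) (κ ε : ℝ) : Prop where
  regular : ∀ᵐ ω ∂P, Regular M κ ω
  one_le : 1 ≤ M
  pos : 0 < κ
  eps_pos : 0 < ε
  kalikow : ∀ L N : ℕ, ∀ x ∈ Finset.Icc (-(L : ℤ)) N,
    ε ≤ kalikowQuotient P (Finset.Icc (-(L : ℤ)) N) x

/-- A walk of range `0` never moves, so its drift vanishes and the quotient for `U = {0}` is `0`,
against `ε > 0`. -/
theorem one_le_of_kalikowCondition {P : Measure Env} [IsProbabilityMeasure P]
    (hRange : FiniteRange P M) (hKal : KalikowCondition P M) : 1 ≤ M := by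
  by_contra hM
  obtain rfl : M = 0 := by omega
  obtain ⟨-, ε, hε, hglb⟩ := hKal
  have hle : ε ≤ kalikowQuotient P {0} 0 := hglb.1
    ⟨{0}, by simp, ⟨[0], by simp, by simp⟩, 0, by simp, rfl⟩
  have hfst : Measure.QuasiMeasurePreserving (Prod.fst : Env × (ℕ → ℤ) → Env)
      (annealedLaw P 0) P := ⟨measurable_fst, by
    have : (annealedLaw P 0).map Prod.fst = P := Measure.fst_compProd P (quenchedKernel 0)
    rw [this]⟩
  have h0 : kalikowQuotient P {0} 0 = 0 := by
    unfold kalikowQuotient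
    rw [integral_eq_zero_of_ae, zero_div]
    filter_upwards [hfst.ae hRange] with q hq
    refine (tsum_congr fun j => ?_).trans tsum_zero
    split_ifs with hj
    · refine (tsum_congr fun i => ?_).trans tsum_zero
      by_cases hi : i = 0
      · simp [hi]
      · have : (shift (q.2 j) q.1).1 0 i = 0 := hq _ _ (by simpa using hi)
        rw [this, mul_zero]
    · rfl
  linarith

theorem KalikowCondition.setting {P : Measure Env} [IsProbabilityMeasure P]
    (hRange : FiniteRange P M) (hKal : KalikowCondition P M) : ∃ κ ε, Setting P M κ ε := by
  have hM := one_le_of_kalikowCondition hRange hKal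
  obtain ⟨⟨κ, hκ, -, hell⟩, ε, hε, hglb⟩ := hKal
  refine ⟨κ, ε, ?_, hM, hκ, hε, fun L N x hx => hglb.1
    ⟨_, by simp, mConnected_Icc hM L N, x, hx, rfl⟩⟩
  filter_upwards [hRange, hell] with ω h1 h2
  exact ⟨hκ, h1, h2⟩

/-- Finite speed: `n` steps see only the sites within distance `n * M`. This allows the passages
from intervals to half-lines and from half-lines to `ℤ` to be made on partial sums. -/
theorem iterate_killed_congr {U V : Set ℤ} {f g : ℤ → ℝ≥0∞} (n : ℕ) (i : ℤ)
    (hUV : ∀ e, |e - i| ≤ (n : ℤ) * M → (e ∈ U ↔ e ∈ V))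
    (hfg : ∀ e, |e - i| ≤ (n : ℤ) * M → f e = g e) :
    (killed M ω U)^[n] f i = (killed M ω V)^[n] g i := by
  induction n generalizing i with
  | zero => exact hfg i (by simp)
  | succ n ih =>
    simp only [Function.iterate_succ_apply', killed]
    have hi : i ∈ U ↔ i ∈ V := hUV i (by simp)
    by_cases h : i ∈ U
    · rw [Set.indicator_of_mem h, Set.indicator_of_mem (hi.1 h)]
      refine Finset.sum_congr rfl fun e he => ?_
      have hstep : ∀ e', |e' - e| ≤ (n : ℤ) * M → |e' - i| ≤ ((n + 1 : ℕ) : ℤ) * M := by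
        intro e' he'
        rw [Finset.mem_Icc] at he
        rw [abs_le] at he' ⊢
        push_cast
        constructor <;> linarith [he.1, he.2, he'.1, he'.2]
      have := ih e (fun e' he' => hUV e' (hstep e' he')) (fun e' he' => hfg e' (hstep e' he'))
      rw [this]
    · rw [Set.indicator_of_notMem h, Set.indicator_of_notMem (mt hi.2 h)]

namespace Setting

variable {P : Measure Env} [IsProbabilityMeasure P] {ε : ℝ}

/-- Kalikow's condition bounds `ε` times the mean time at each `x` by the mean drift collected at
`x`, and the sum of the latter over `x` is at most `N + M`. -/
theorem lintegral_pot_Icc_le (hS : Setting P M κ ε) (L N : ℕ) :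
    ∫⁻ ω, pot M ω (Set.Icc (-(L : ℤ)) N) ((Set.Icc (-(L : ℤ)) N).indicator 1) 0 ∂P ≤
      ENNReal.ofReal ((N + M) / ε) := by
  set U := Finset.Icc (-(L : ℤ)) (N : ℤ) with hU
  obtain ⟨B, hB, hpot⟩ := exists_pot_Icc_le hS.one_le hS.pos L N
  have hle : ∀ ω, Regular M κ ω → ∀ x ∈ U, pot M ω U (delta x) 0 ≤ B := by
    intro ω hω x hx
    refine ((Finset.single_le_sum (f := fun x => pot M ω U (delta x) 0)
      (fun _ _ => zero_le) hx).trans (sum_pot_delta_le subset_rfl 0)).trans ?_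
    rw [hU, Finset.coe_Icc]
    exact hpot ω hω 0
  have hfin : ∀ x ∈ U, ∫⁻ ω, pot M ω U (delta x) 0 ∂P ≠ ∞ := by
    intro x hx
    refine ((lintegral_mono_ae (g := fun _ => B) ?_).trans_lt ?_).ne
    · filter_upwards [hS.regular] with ω hω using hle ω hω x hx
    · simpa using hB.lt_top
  have hint : ∀ x ∈ U, Integrable (fun ω => (pot M ω U (delta x) 0).toReal) P := fun x hx =>
    integrable_toReal_of_lintegral_ne_top (measurable_pot _ _ _).aemeasurable (hfin x hx)
  have hint' : ∀ x ∈ U, Integrable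
      (fun ω => drift (shift x ω) * (pot M ω U (delta x) 0).toReal) P := fun x hx =>
    (hint x hx).bdd_mul (c := M) (aemeasurable_drift_shift hS.regular x).aestronglyMeasurable (by
      filter_upwards [hS.regular] with ω hω using hω.abs_drift_shift_le x)
  have hkal : ∀ x ∈ U, ε * ∫ ω, (pot M ω U (delta x) 0).toReal ∂P ≤
      ∫ ω, drift (shift x ω) * (pot M ω U (delta x) 0).toReal ∂P := by
    intro x hx
    have hq := hS.kalikow L N x hx
    rw [kalikowQuotient_eq hS.regular _ x (hfin x hx)] at hq
    have h0 : 0 ≤ ∫ ω, (pot M ω U (delta x) 0).toReal ∂P :=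
      integral_nonneg fun _ => ENNReal.toReal_nonneg
    -- A zero denominator would make the quotient `0` by the convention on division, which `hq`
    -- excludes.
    rcases h0.eq_or_lt with h | h
    · rw [← h, div_zero] at hq
      exact absurd hq (not_le.2 hS.eps_pos)
    · exact (le_div_iff₀ h).1 hq
  have hsum : ∑ x ∈ U, ∫ ω, (pot M ω U (delta x) 0).toReal ∂P ≤ (N + M) / ε := by
    rw [le_div_iff₀ hS.eps_pos, mul_comm, Finset.mul_sum]
    refine (Finset.sum_le_sum hkal).trans ?_
    rw [← integral_finsetSum _ hint']
    have : ∫ _ : Env, ((N : ℝ) + M) ∂P = N + M := by simp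
    rw [← this]
    refine integral_mono_ae (integrable_finsetSum _ hint') (integrable_const _) ?_
    filter_upwards [hS.regular] with ω hω
    exact hω.sum_pot_mul_drift_le hS.one_le L N
  have heq : ∀ x ∈ U, ∫⁻ ω, pot M ω U (delta x) 0 ∂P =
      ENNReal.ofReal (∫ ω, (pot M ω U (delta x) 0).toReal ∂P) := by
    intro x hx
    rw [integral_toReal (measurable_pot _ _ _).aemeasurable
      (ae_lt_top (measurable_pot _ _ _) (hfin x hx)), ENNReal.ofReal_toReal (hfin x hx)]
  have hUc : Set.Icc (-(L : ℤ)) (N : ℤ) = (U : Set ℤ) := by rw [hU, Finset.coe_Icc]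
  rw [hUc]
  simp_rw [← sum_delta, ← sum_pot]
  rw [lintegral_finsetSum _ fun x _ => measurable_pot _ _ _, Finset.sum_congr rfl heq,
    ← ENNReal.ofReal_sum_of_nonneg fun x _ => integral_nonneg fun _ => ENNReal.toReal_nonneg]
  exact ENNReal.ofReal_le_ofReal hsum

/-- The mean exit time of a left half-line grows at most linearly. -/
theorem lintegral_pot_Iic_le (hS : Setting P M κ ε) (N : ℕ) :
    ∫⁻ ω, pot M ω (Set.Iic (N : ℤ)) ((Set.Iic (N : ℤ)).indicator 1) 0 ∂P ≤
      ENNReal.ofReal ((N + M) / ε) := by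
  unfold pot
  rw [lintegral_tsum fun n => (measurable_iterate_killed _ _ _ _).aemeasurable]
  refine ENNReal.tsum_le_of_sum_range_le fun K => ?_
  -- The first `K` terms involve fewer than `K` steps from `0`, so a left end at `-K * M` is not
  -- felt, and the bound does not depend on it.
  refine le_trans ?_ (hS.lintegral_pot_Icc_le (K * M) N)
  rw [← lintegral_finsetSum _ fun n _ => measurable_iterate_killed _ _ _ _]
  refine lintegral_mono fun ω => ?_
  refine le_trans (Finset.sum_le_sum fun n hn => ?_) (ENNReal.sum_le_tsum (Finset.range K))
  have hU : ∀ e : ℤ, |e - 0| ≤ (n : ℤ) * M →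
      (e ∈ Set.Iic (N : ℤ) ↔ e ∈ Set.Icc (-((K * M : ℕ) : ℤ)) N) := by
    intro e he
    have h1 : (n : ℤ) * M ≤ K * M := by
      have := Finset.mem_range.1 hn
      exact mul_le_mul_of_nonneg_right (by exact_mod_cast this.le) (by positivity)
    rw [sub_zero, abs_le] at he
    push_cast
    simp only [Set.mem_Iic, Set.mem_Icc]
    constructor
    · intro h; exact ⟨by linarith [he.1], h⟩
    · exact fun h => h.2
  refine (iterate_killed_congr n 0 hU fun e he => ?_).le
  simp only [Set.indicator_apply, hU e he]

end Setting

/-! ### Stationarity and integrability of the diagonal Green function. -/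

theorem shift_shift (a b : ℤ) (ω : Env) : shift a (shift b ω) = shift (b + a) ω := by
  refine Subtype.ext (funext fun i => funext fun j => ?_)
  simp [shift, add_assoc]

theorem shift_zero (ω : Env) : shift 0 ω = ω := by
  refine Subtype.ext (funext fun i => funext fun j => ?_)
  simp [shift]

/-- The shift as an automorphism of the space of environments. -/
def shiftEquiv (k : ℤ) : Env ≃ᵐ Env where
  toFun := shift k
  invFun := shift (-k)
  left_inv ω := by rw [shift_shift, add_neg_cancel, shift_zero]
  right_inv ω := by rw [shift_shift, neg_add_cancel, shift_zero]
  measurable_toFun := measurable_shift k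
  measurable_invFun := measurable_shift (-k)

theorem measurePreserving_shift {P : Measure Env} (h : MeasurePreserving (shift 1) P P) (k : ℤ) :
    MeasurePreserving (shift k) P P := by
  have hneg : MeasurePreserving (shift (-1)) P P :=
    MeasurePreserving.symm (shiftEquiv 1) h
  induction k using Int.induction_on with
  | zero =>
    have : shift 0 = id := funext shift_zero
    rw [this]; exact MeasurePreserving.id P
  | succ n ih =>
    have : shift ((n : ℤ) + 1) = shift 1 ∘ shift n := funext fun ω => (shift_shift 1 n ω).symm
    rw [this]; exact h.comp ih
  | pred n ih =>
    have : shift (-(n : ℤ) - 1) = shift (-1) ∘ shift (-n) :=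
      funext fun ω => (shift_shift (-1) (-n) ω).symm
    rw [this]; exact hneg.comp ih

namespace Regular

theorem lt_one (hω : Regular M κ ω) : κ < 1 :=
  (hω.elliptic 0 0 (by simp)).trans_le (ω.2.1 0 0).2

/-- Ellipticity bounds the Green function at points on the left of `j` from below. -/
theorem mul_pot_delta_le (hω : Regular M κ ω) {U : Set ℤ} {j : ℤ}
    (hU : Set.Iic (j + M - 1) ⊆ U) (hM : 1 ≤ M)
    (hesc : ∀ i N : ℤ, pot M ω (Set.Iic N) ((Set.Iic N).indicator 1) i ≠ ∞)
    (hG : pot M ω U (delta j) j ≠ ∞) {i : ℤ} (hij : i ≤ j) :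
    ENNReal.ofReal κ * pot M ω U (delta j) j ≤ pot M ω U (delta j) i := by
  have hfin : ∀ e, pot M ω U (delta j) e ≠ ∞ := fun e =>
    ((hω.pot_delta_le U e j).trans_lt hG.lt_top).ne
  set g : ℤ → ℝ := fun e => (pot M ω U (delta j) e).toReal with hg
  have hg0 : ∀ e, 0 ≤ g e := fun e => ENNReal.toReal_nonneg
  have hκ := hω.pos
  have hκ1 := hω.lt_one
  have hharm : ∀ e ∈ U, e ≠ j → g e = ravg M ω g e := by
    intro e he hej
    have : pot M ω U (delta j) e = avg M ω (pot M ω U (delta j)) e := by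
      rw [pot_of_mem he, delta_of_ne hej, zero_add]
    simp only [hg]
    rw [this, toReal_avg hfin]
  have key : κ * g j ≤ g i := by
    rcases hij.eq_or_lt with rfl | hlt
    · nlinarith [hg0 i]
    -- From the left of `j` the walk escapes through the window `[j, j + M - 1]`. There `g ≥ κ * g
    -- j`, either at `j` itself or by a jump to `j`; `hU` keeps the window inside `U`, where `g` is
    -- harmonic off `j`.
    have hmin := hω.nonneg_of_superharmonic (U := Set.Iic (j - 1)) (h := fun e => g e - κ * g j)
      (B := κ * g j) (fun e _ => by linarith [hg0 e]) (fun e he => ?_) (fun e he e' he' hd => ?_)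
      (fun e _ => tendsto_of_pot_ne_top (hesc e _)) i (by simp; omega)
    · linarith
    · have he' : e ≤ j - 1 := he
      rw [ravg_sub, hω.ravg_const, ← hharm e (hU (by simp; omega)) (by omega)]
    · have h1 : e ≤ j - 1 := he
      have h2 : j - 1 < e' := by simpa using he'
      rw [abs_le] at hd
      by_cases hej : e' = j
      · simp only [hej]; nlinarith [hg0 j]
      · have h3 : ω.1 e' j * g j ≤ ravg M ω g e' :=
          Finset.single_le_sum (f := fun x => ω.1 e' x * g x)
            (fun x _ => mul_nonneg (ω.2.1 e' x).1 (hg0 x)) (by rw [Finset.mem_Icc]; omega)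
        have h4 : κ < ω.1 e' j := hω.elliptic _ _ (by rw [abs_le]; omega)
        have h5 := mul_le_mul_of_nonneg_right h4.le (hg0 j)
        rw [← hharm e' (hU (by simp; omega)) hej] at h3
        linarith
  rw [← ENNReal.ofReal_toReal hG, ← ENNReal.ofReal_toReal (hfin i), ← ENNReal.ofReal_mul hκ.le]
  exact ENNReal.ofReal_le_ofReal key

end Regular

namespace Setting

variable {P : Measure Env} [IsProbabilityMeasure P] {ε : ℝ}

theorem ae_escape (hS : Setting P M κ ε) (hP : MeasurePreserving (shift 1) P P) :
    ∀ᵐ ω ∂P, ∀ i N : ℤ, pot M ω (Set.Iic N) ((Set.Iic N).indicator 1) i ≠ ∞ := by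
  have h0 : ∀ᵐ ω ∂P, ∀ N : ℕ,
      pot M ω (Set.Iic (N : ℤ)) ((Set.Iic (N : ℤ)).indicator 1) 0 ≠ ∞ := by
    rw [ae_all_iff]
    intro N
    filter_upwards [ae_lt_top (measurable_pot _ _ _)
      ((hS.lintegral_pot_Iic_le N).trans_lt ENNReal.ofReal_lt_top).ne] with ω hω using hω.ne
  have h1 : ∀ᵐ ω ∂P, ∀ i : ℤ, ∀ N : ℕ,
      pot M (shift i ω) (Set.Iic (N : ℤ)) ((Set.Iic (N : ℤ)).indicator 1) 0 ≠ ∞ := by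
    rw [ae_all_iff]
    exact fun i => (measurePreserving_shift hP i).quasiMeasurePreserving.ae h0
  filter_upwards [h1] with ω hω i N
  by_cases hi : i ≤ N
  · have h2 := hω i (N - i).toNat
    rw [pot_shift, add_zero] at h2
    have h3 : (((N - i).toNat : ℕ) : ℤ) = N - i := Int.toNat_of_nonneg (by omega)
    have h4 : (· - i) ⁻¹' Set.Iic (((N - i).toNat : ℕ) : ℤ) = Set.Iic N := by
      ext e; simp only [Set.mem_preimage, Set.mem_Iic]; omega
    rw [h4] at h2
    convert h2 using 2
    funext e
    simp only [Set.indicator_apply, Set.mem_Iic]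
    exact if_congr (by omega) rfl rfl
  · rw [pot_of_notMem (by simpa using hi)]
    simp [hi]

/-- By stationarity each `j` in `[0, n]` has the same mean diagonal Green function as `0`, up to
enlarging the half-line. By ellipticity, `κ` times it bounds the mean visits from `0` to `j` from
below. These `n + 1` terms add up to at most a mean exit time linear in `n`, so the bound is uniform
in `n`. -/
theorem lintegral_pot_Iic_delta_le (hS : Setting P M κ ε) (hP : MeasurePreserving (shift 1) P P)
    (n : ℕ) : ∫⁻ ω, pot M ω (Set.Iic (n : ℤ)) (delta 0) 0 ∂P ≤
      ENNReal.ofReal (2 * M / ε) / ENNReal.ofReal κ := by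
  have hε := hS.eps_pos
  -- For `0 ≤ j ≤ n`, the level `N` exceeds both `n + j`, the translated level, and `j + M - 1`, the
  -- end of the window to the right of `j`. Moreover `N + M = 2 * (n + M) ≤ (n + 1) * (2 * M)`
  -- because `M ≥ 1`.
  set N : ℕ := 2 * n + M with hN
  set I := ∫⁻ ω, pot M ω (Set.Iic (n : ℤ)) (delta 0) 0 ∂P with hI
  have hj : ∀ j ∈ Finset.Icc (0 : ℤ) n, ENNReal.ofReal κ * I ≤
      ∫⁻ ω, pot M ω (Set.Iic (N : ℤ)) (delta j) 0 ∂P := by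
    intro j hj
    rw [Finset.mem_Icc] at hj
    have h1 : I ≤ ∫⁻ ω, pot M ω (Set.Iic (N : ℤ)) (delta j) j ∂P := by
      rw [hI, ← (measurePreserving_shift hP j).lintegral_comp (measurable_pot _ _ _)]
      refine lintegral_mono fun ω => ?_
      rw [pot_shift, delta_sub, add_zero]
      refine pot_mono (fun e he => ?_) le_rfl j
      simp only [Set.mem_preimage, Set.mem_Iic] at he ⊢
      push_cast [hN]
      omega
    refine (mul_le_mul_right h1 _).trans ?_
    rw [← lintegral_const_mul _ (measurable_pot _ _ _)]
    refine lintegral_mono_ae ?_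
    filter_upwards [hS.regular, hS.ae_escape hP] with ω hω hesc
    refine hω.mul_pot_delta_le (fun e he => ?_) hS.one_le hesc ?_ hj.1
    · simp only [Set.mem_Iic] at he ⊢
      push_cast [hN]
      omega
    · have hs : ((({j} : Finset ℤ) : Set ℤ)) ⊆ Set.Iic (N : ℤ) := by
        simp; omega
      have := sum_pot_delta_le (M := M) (ω := ω) hs j
      rw [Finset.sum_singleton] at this
      exact (this.trans_lt (hesc j N).lt_top).ne
  have hs : ((Finset.Icc (0 : ℤ) n : Finset ℤ) : Set ℤ) ⊆ Set.Iic (N : ℤ) := by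
    intro e he
    simp only [Finset.coe_Icc, Set.mem_Icc, Set.mem_Iic] at he ⊢
    push_cast [hN]
    omega
  have hsum : ((n + 1 : ℕ) : ℝ≥0∞) * (ENNReal.ofReal κ * I) ≤
      ((n + 1 : ℕ) : ℝ≥0∞) * ENNReal.ofReal (2 * M / ε) := by
    calc ((n + 1 : ℕ) : ℝ≥0∞) * (ENNReal.ofReal κ * I)
        = ∑ j ∈ Finset.Icc (0 : ℤ) n, ENNReal.ofReal κ * I := by
          rw [Finset.sum_const, Int.card_Icc, nsmul_eq_mul]
          congr 2
      _ ≤ ∑ j ∈ Finset.Icc (0 : ℤ) n, ∫⁻ ω, pot M ω (Set.Iic (N : ℤ)) (delta j) 0 ∂P :=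
          Finset.sum_le_sum hj
      _ = ∫⁻ ω, ∑ j ∈ Finset.Icc (0 : ℤ) n, pot M ω (Set.Iic (N : ℤ)) (delta j) 0 ∂P :=
          (lintegral_finsetSum _ fun j _ => measurable_pot _ _ _).symm
      _ ≤ ∫⁻ ω, pot M ω (Set.Iic (N : ℤ)) ((Set.Iic (N : ℤ)).indicator 1) 0 ∂P :=
          lintegral_mono fun ω => sum_pot_delta_le hs 0
      _ ≤ ENNReal.ofReal ((N + M) / ε) := hS.lintegral_pot_Iic_le N
      _ ≤ ENNReal.ofReal (((n + 1 : ℕ) : ℝ) * (2 * M / ε)) := by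
          refine ENNReal.ofReal_le_ofReal ?_
          rw [← mul_div_assoc]
          refine div_le_div_of_nonneg_right ?_ hε.le
          have h1 : (1 : ℝ) ≤ M := by exact_mod_cast hS.one_le
          have h2 : (0 : ℝ) ≤ n := n.cast_nonneg
          push_cast [hN]
          nlinarith
      _ = _ := by rw [ENNReal.ofReal_mul (by positivity), ENNReal.ofReal_natCast]
  rw [ENNReal.le_div_iff_mul_le (Or.inl (by simpa using hS.pos)) (Or.inl ENNReal.ofReal_ne_top),
    mul_comm]
  exact (ENNReal.mul_le_mul_iff_right (by simp) (ENNReal.natCast_ne_top _)).1 hsum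

/-- The Green function on the diagonal is integrable. -/
theorem lintegral_pot_univ_ne_top (hS : Setting P M κ ε) (hP : MeasurePreserving (shift 1) P P) :
    ∫⁻ ω, pot M ω Set.univ (delta 0) 0 ∂P ≠ ∞ := by
  refine ne_top_of_le_ne_top (b := ENNReal.ofReal (2 * M / ε) / ENNReal.ofReal κ)
    (ENNReal.div_ne_top ENNReal.ofReal_ne_top (by simpa using hS.pos)) ?_
  unfold pot
  rw [lintegral_tsum fun n => (measurable_iterate_killed _ _ _ _).aemeasurable]
  refine ENNReal.tsum_le_of_sum_range_le fun K => ?_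
  refine le_trans ?_ (hS.lintegral_pot_Iic_delta_le hP (K * M))
  rw [← lintegral_finsetSum _ fun n _ => measurable_iterate_killed _ _ _ _]
  refine lintegral_mono fun ω => ?_
  refine le_trans (Finset.sum_le_sum fun n hn => ?_) (ENNReal.sum_le_tsum (Finset.range K))
  refine (iterate_killed_congr n 0 (fun e he => ?_) fun e _ => rfl).le
  have h1 : (n : ℤ) * M ≤ K * M := by
    have := Finset.mem_range.1 hn
    exact mul_le_mul_of_nonneg_right (by exact_mod_cast this.le) (by positivity)
  rw [sub_zero, abs_le] at he
  simp only [Set.mem_univ, Set.mem_Iic, true_iff]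
  push_cast
  linarith [he.2]

end Setting

/-! ### Oscillation of harmonic functions and the Liouville property. -/

/-- The almost sure properties of the environment: it is regular, the walk escapes to the right,
and its Green function is finite. -/
structure Transient (M : ℕ) (κ : ℝ) (ω : Env) : Prop where
  regular : Regular M κ ω
  one_le : 1 ≤ M
  escape : ∀ i N : ℤ, pot M ω (Set.Iic N) ((Set.Iic N).indicator 1) i ≠ ∞
  pot_ne_top : ∀ j : ℤ, pot M ω Set.univ (delta j) j ≠ ∞

theorem Setting.ae_transient {P : Measure Env} [IsProbabilityMeasure P] {ε : ℝ}
    (hS : Setting P M κ ε) (hP : MeasurePreserving (shift 1) P P) :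
    ∀ᵐ ω ∂P, Transient M κ ω := by
  have h0 : ∀ᵐ ω ∂P, ∀ j : ℤ, pot M (shift j ω) Set.univ (delta 0) 0 < ∞ := by
    rw [ae_all_iff]
    exact fun j => (measurePreserving_shift hP j).quasiMeasurePreserving.ae
      (ae_lt_top (measurable_pot _ _ _) (hS.lintegral_pot_univ_ne_top hP))
  filter_upwards [hS.regular, hS.ae_escape hP, h0] with ω h1 h2 h3
  refine ⟨h1, hS.one_le, h2, fun j => ?_⟩
  have := h3 j
  rw [pot_shift, delta_sub, add_zero, Set.preimage_univ] at this
  exact this.ne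

namespace Transient

/-- The walk escapes to the right and must land in the window `(N - M, N]`, whose sites all jump to
`N - M + 1` with probability larger than `κ`; otherwise `h` is at least `a`. The minimum principle
carries the bound from the window to its left. -/
theorem le_of_harmonic (hω : Transient M κ ω) {h : ℤ → ℝ} {N : ℤ} {a : ℝ}
    (hh : ∀ i ≤ N, ravg M ω h i = h i) (ha : ∀ i ≤ N + M, a ≤ h i) :
    ∀ i ≤ N, κ * h (N - M + 1) + (1 - κ) * a ≤ h i := by
  have hκ := hω.regular.pos
  have hM := hω.one_le
  have ha0 := ha (N - M + 1) (by omega)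
  have hnear : ∀ i ≤ N, N - M < i → κ * h (N - M + 1) + (1 - κ) * a ≤ h i := by
    intro i hi hi'
    have h1 : ω.1 i (N - M + 1) * (h (N - M + 1) - a) ≤ ravg M ω (fun e => h e - a) i := by
      refine Finset.single_le_sum (f := fun e => ω.1 i e * (h e - a)) (fun e he => ?_) ?_
      · rw [Finset.mem_Icc] at he
        exact mul_nonneg (ω.2.1 i e).1 (by linarith [ha e (by linarith [he.2])])
      · rw [Finset.mem_Icc]; omega
    have h2 : κ < ω.1 i (N - M + 1) := hω.regular.elliptic _ _ (by rw [abs_le]; omega)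
    rw [ravg_sub, hω.regular.ravg_const, hh i hi] at h1
    nlinarith
  intro i hi
  by_cases hi' : N - M < i
  · exact hnear i hi hi'
  have hmin := hω.regular.nonneg_of_superharmonic (U := Set.Iic (N - M))
    (h := fun e => h e - (κ * h (N - M + 1) + (1 - κ) * a)) (B := κ * (h (N - M + 1) - a))
    (fun e he => ?_) (fun e he => ?_) (fun e he e' he' hd => ?_)
    (fun e _ => tendsto_of_pot_ne_top (hω.escape e _)) i (by simpa using hi')
  · linarith
  · have := ha e (by have : e ≤ N - M := he; omega)
    linarith
  · rw [ravg_sub, hω.regular.ravg_const, hh e (by have : e ≤ N - M := he; omega)]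
  · have h1 : e ≤ N - M := he
    have h2 : N - M < e' := by simpa using he'
    rw [abs_le] at hd
    linarith [hnear e' (by omega) h2]

/-- The lower bound of `le_of_harmonic` for `h` and the one for `-h` share the term `κ * h (N - M +
1)`. It cancels in the difference, so each block of `M` sites contracts the oscillation by `1 - κ`.
-/
theorem oscillation_le (hω : Transient M κ ω) {h : ℤ → ℝ} {N : ℤ} {a b : ℝ}
    (hh : ∀ i ≤ N, ravg M ω h i = h i) (hab : ∀ i ≤ N + M, a ≤ h i ∧ h i ≤ b) (r : ℕ) :
    ∃ a' b' : ℝ, b' - a' = (1 - κ) ^ r * (b - a) ∧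
      ∀ i ≤ N + M - r * M, a' ≤ h i ∧ h i ≤ b' := by
  induction r with
  | zero => exact ⟨a, b, by simp, fun i hi => hab i (by simpa using hi)⟩
  | succ r ih =>
    obtain ⟨a', b', hd, hb⟩ := ih
    have h0 : (0 : ℤ) ≤ r * M := by positivity
    set N' : ℤ := N - r * M with hN'
    have hN : N + M - r * M = N' + M := by omega
    rw [hN] at hb
    have hlow := hω.le_of_harmonic (N := N') (fun i hi => hh i (by omega)) fun i hi => (hb i hi).1
    have hup := hω.le_of_harmonic (N := N') (h := fun e => -h e) (a := -b')
      (fun i hi => by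
        rw [← hh i (by omega)]; simp [ravg]) fun i hi => neg_le_neg (hb i hi).2
    refine ⟨_, κ * h (N' - M + 1) + (1 - κ) * b', ?_, fun i hi => ⟨hlow i ?_, ?_⟩⟩
    · rw [pow_succ]; linear_combination (1 - κ) * hd
    · push_cast at hi; linarith
    · have := hup i (by push_cast at hi; linarith)
      linarith

theorem exists_tendsto_atBot (hω : Transient M κ ω) {h : ℤ → ℝ} {N : ℤ} {a b : ℝ}
    (hh : ∀ i ≤ N, ravg M ω h i = h i) (hab : ∀ i ≤ N + M, a ≤ h i ∧ h i ≤ b) :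
    ∃ l, Tendsto h atBot (𝓝 l) := by
  rw [← cauchy_map_iff_exists_tendsto, Metric.cauchy_iff]
  refine ⟨inferInstance, fun ε hε => ?_⟩
  have hlim : Tendsto (fun r : ℕ => (1 - κ) ^ r * (b - a)) atTop (𝓝 (0 * (b - a))) :=
    (tendsto_pow_atTop_nhds_zero_of_lt_one (by linarith [hω.regular.lt_one])
      (by linarith [hω.regular.pos])).mul_const _
  rw [zero_mul] at hlim
  obtain ⟨r, hr⟩ := (hlim.eventually (gt_mem_nhds hε)).exists
  obtain ⟨a', b', hd, hb⟩ := hω.oscillation_le hh hab r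
  refine ⟨h '' Set.Iic (N + M - r * M), image_mem_map (Iic_mem_atBot _), ?_⟩
  rintro _ ⟨i, hi, rfl⟩ _ ⟨j, hj, rfl⟩
  have h1 := hb i hi
  have h2 := hb j hj
  rw [Real.dist_eq, abs_lt]
  constructor <;> linarith

/-- The Liouville property: bounded harmonic functions are constant. -/
theorem harmonic_eq (hω : Transient M κ ω) {h : ℤ → ℝ} {a b : ℝ}
    (hh : ∀ i, ravg M ω h i = h i) (hab : ∀ i, a ≤ h i ∧ h i ≤ b) (i j : ℤ) : h i = h j := by
  have hlim : Tendsto (fun r : ℕ => (1 - κ) ^ r * (b - a)) atTop (𝓝 (0 * (b - a))) :=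
    (tendsto_pow_atTop_nhds_zero_of_lt_one (by linarith [hω.regular.lt_one])
      (by linarith [hω.regular.pos])).mul_const _
  rw [zero_mul] at hlim
  have hle : ∀ r : ℕ, |h i - h j| ≤ (1 - κ) ^ r * (b - a) := by
    intro r
    -- Starting `r` blocks to the right leaves `i` and `j` in range after `r` contractions, and `r`
    -- is arbitrary.
    obtain ⟨a', b', hd, hb⟩ := hω.oscillation_le (N := max i j + r * M) (fun i _ => hh i)
      (fun i _ => hab i) r
    have h1 := hb i (by have := le_max_left i j; linarith [Int.natCast_nonneg M])
    have h2 := hb j (by have := le_max_right i j; linarith [Int.natCast_nonneg M])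
    rw [← hd, abs_le]
    constructor <;> linarith
  have := ge_of_tendsto' hlim hle
  exact sub_eq_zero.1 (abs_nonpos_iff.1 this)

theorem shift (hω : Transient M κ ω) (k : ℤ) : Transient M κ (shift k ω) := by
  refine ⟨hω.regular.shift k, hω.one_le, fun i N => ?_, fun j => ?_⟩
  · rw [pot_shift]
    convert hω.escape (k + i) (N + k) using 2
    · ext e; simp
    · funext e
      simp only [Set.indicator_apply, Set.mem_Iic, sub_le_iff_le_add]
      rfl
  · rw [pot_shift, delta_sub, Set.preimage_univ]
    exact hω.pot_ne_top _

theorem green_ne_top (hω : Transient M κ ω) (i j : ℤ) : green i j ω ≠ ∞ := by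
  rw [hω.regular.green_eq_pot]
  exact ((hω.regular.pot_delta_le _ i j).trans_lt (hω.pot_ne_top j).lt_top).ne

theorem green_le (hω : Transient M κ ω) (i j : ℤ) : green i j ω ≤ green j j ω := by
  rw [hω.regular.green_eq_pot, hω.regular.green_eq_pot]
  exact hω.regular.pot_delta_le _ i j

theorem le_green (hω : Transient M κ ω) {i j : ℤ} (hij : i ≤ j) :
    ENNReal.ofReal κ ≤ green i j ω := by
  rw [hω.regular.green_eq_pot]
  refine le_trans ?_ (hω.regular.mul_pot_delta_le (Set.subset_univ _) hω.one_le hω.escape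
    (hω.pot_ne_top j) hij)
  refine le_mul_of_one_le_right zero_le ?_
  rw [pot_eq, delta_self]
  exact le_self_add

/-- Strictly to the left of `j`, the function `i ↦ g_{ij}` is harmonic, and it is bounded by
`g_{jj}`. -/
theorem exists_tendsto_green (hω : Transient M κ ω) (j : ℤ) :
    ∃ l : ℝ≥0∞, l ≠ ∞ ∧ Tendsto (fun k => green k j ω) atBot (𝓝 l) := by
  have hfin : ∀ i, pot M ω Set.univ (delta j) i ≠ ∞ := fun i => by
    rw [← hω.regular.green_eq_pot]; exact hω.green_ne_top i j
  obtain ⟨l, hl⟩ := hω.exists_tendsto_atBot (N := j - 1)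
    (h := fun i => (pot M ω Set.univ (delta j) i).toReal) (a := 0)
    (b := (pot M ω Set.univ (delta j) j).toReal)
    (fun i hi => by
      rw [← toReal_avg hfin, pot_of_mem (Set.mem_univ i), delta_of_ne (by omega), zero_add])
    (fun i _ => ⟨ENNReal.toReal_nonneg,
      ENNReal.toReal_mono (hfin j) (hω.regular.pot_delta_le _ i j)⟩)
  refine ⟨ENNReal.ofReal l, ENNReal.ofReal_ne_top, ?_⟩
  refine (ENNReal.tendsto_ofReal hl).congr fun k => ?_
  rw [ENNReal.ofReal_toReal (hfin k), hω.regular.green_eq_pot]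

theorem green_shift (hω : Transient M κ ω) (k i j : ℤ) :
    green i j (RWRE.shift k ω) = green (k + i) (k + j) ω := by
  rw [(hω.regular.shift k).green_eq_pot, hω.regular.green_eq_pot, pot_shift, delta_sub,
    Set.preimage_univ]

/-- The decomposition of the Green function at the last step. -/
theorem green_zero_eq (hω : Transient M κ ω) (i : ℤ) :
    green i 0 ω = delta 0 i +
      ∑ j ∈ Finset.Icc (-(M : ℤ)) M, ENNReal.ofReal (ω.1 j 0) * green i j ω := by
  -- Applying the transition operator to `delta 0` spreads it over the sites that can jump to `0`.
  -- Peeling off the innermost application instead of the outermost one conditions on the last step.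
  have h1 : killed M ω Set.univ (delta 0) =
      fun e => ∑ j ∈ Finset.Icc (-(M : ℤ)) M, ENNReal.ofReal (ω.1 j 0) * delta j e := by
    funext e
    have hl : killed M ω Set.univ (delta 0) e = ENNReal.ofReal (ω.1 e 0) := by
      rw [killed, Set.indicator_univ, ← hω.regular.tsum_row, tsum_eq_single 0]
      · rw [delta_self, mul_one]
      · intro b hb; rw [delta_of_ne hb, mul_zero]
    rw [hl]
    by_cases he : e ∈ Finset.Icc (-(M : ℤ)) M
    · rw [Finset.sum_eq_single_of_mem e he, delta_self, mul_one]
      intro b _ hb; rw [delta_of_ne hb.symm, mul_zero]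
    · rw [Finset.sum_eq_zero, hω.regular.range, ENNReal.ofReal_zero]
      · rw [Finset.mem_Icc] at he
        rw [sub_zero, lt_abs]; omega
      · intro b hb
        rw [delta_of_ne (fun h : e = b => he (by rw [h]; exact hb)), mul_zero]
  have h2 : pot M ω Set.univ (delta 0) i =
      delta 0 i + pot M ω Set.univ (killed M ω Set.univ (delta 0)) i := by
    unfold pot
    rw [tsum_eq_zero_add' ENNReal.summable]
    rfl
  simp_rw [hω.regular.green_eq_pot]
  rw [h2, h1, ← sum_pot]
  simp_rw [pot_const_mul]

end Transient

/-! ### The limit Green function and the invariant measure. -/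

theorem measurable_green (i j : ℤ) : Measurable (green i j) :=
  Measurable.tsum fun n => by
    have hs : MeasurableSet {X : ℕ → ℤ | X n = j} :=
      measurableSet_eq_fun (measurable_pi_apply n) measurable_const
    exact (Measure.measurable_coe hs).comp (measurable_quenchedLaw i)

/-- The limit of the Green functions `g_{-n,0}`. -/
noncomputable def limitGreen (ω : Env) : ℝ≥0∞ :=
  limsup (fun n : ℕ => green (-(n : ℤ)) 0 ω) atTop

theorem measurable_limitGreen : Measurable limitGreen :=
  Measurable.limsup fun _ => measurable_green _ _

theorem tendsto_neg_natCast : Tendsto (fun n : ℕ => -(n : ℤ)) atTop atBot :=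
  tendsto_neg_atTop_atBot.comp tendsto_natCast_atTop_atTop

namespace Transient

/-- The `limsup` makes `limitGreen` measurable on all environments; on transient ones it is a limit
along all `k → -∞`, and translation covariance turns the target `j` into a shift of the environment.
-/
theorem tendsto_green (hω : Transient M κ ω) (j : ℤ) :
    Tendsto (fun k => green k j ω) atBot (𝓝 (limitGreen (RWRE.shift j ω))) := by
  obtain ⟨l, -, hl⟩ := hω.exists_tendsto_green j
  have h1 : Tendsto (fun n : ℕ => green (-(n : ℤ)) 0 (RWRE.shift j ω)) atTop (𝓝 l) := by
    have h2 : Tendsto (fun n : ℕ => j + -(n : ℤ)) atTop atBot :=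
      tendsto_atBot_add_const_left _ j tendsto_neg_natCast
    refine (hl.comp h2).congr fun n => ?_
    rw [hω.green_shift, add_zero]
    rfl
  rw [limitGreen, h1.limsup_eq]
  exact hl

theorem tendsto_green_zero (hω : Transient M κ ω) :
    Tendsto (fun k => green k 0 ω) atBot (𝓝 (limitGreen ω)) := by
  simpa [shift_zero] using hω.tendsto_green 0

theorem limitGreen_le (hω : Transient M κ ω) : limitGreen ω ≤ green 0 0 ω :=
  le_of_tendsto' hω.tendsto_green_zero fun k => hω.green_le k 0

theorem le_limitGreen (hω : Transient M κ ω) : ENNReal.ofReal κ ≤ limitGreen ω :=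
  ge_of_tendsto hω.tendsto_green_zero <| (eventually_le_atBot 0).mono fun _ hk => hω.le_green hk

theorem limitGreen_ne_top (hω : Transient M κ ω) : limitGreen ω ≠ ∞ :=
  (hω.limitGreen_le.trans_lt (hω.green_ne_top 0 0).lt_top).ne

/-- Limit `k → -∞` in the last-step decomposition, where the term `delta 0 k` vanishes for `k < 0`
and the sum is finite. This is the stationarity equation for the density. -/
theorem sum_mul_limitGreen (hω : Transient M κ ω) :
    ∑' j : ℤ, ENNReal.ofReal (ω.1 j 0) * limitGreen (RWRE.shift j ω) = limitGreen ω := by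
  rw [tsum_eq_sum (s := Finset.Icc (-(M : ℤ)) M)]
  · have h1 : Tendsto (fun k => ∑ j ∈ Finset.Icc (-(M : ℤ)) M,
        ENNReal.ofReal (ω.1 j 0) * green k j ω) atBot
        (𝓝 (∑ j ∈ Finset.Icc (-(M : ℤ)) M,
          ENNReal.ofReal (ω.1 j 0) * limitGreen (RWRE.shift j ω))) :=
      tendsto_finsetSum _ fun j _ =>
        ENNReal.Tendsto.const_mul (hω.tendsto_green j) (Or.inr ENNReal.ofReal_ne_top)
    refine tendsto_nhds_unique h1 (hω.tendsto_green_zero.congr' ?_)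
    filter_upwards [eventually_lt_atBot 0] with k hk
    rw [hω.green_zero_eq, delta_of_ne hk.ne, zero_add]
  · intro j hj
    rw [hω.regular.range, ENNReal.ofReal_zero, zero_mul]
    rw [Finset.mem_Icc] at hj
    rw [sub_zero, lt_abs]; omega

theorem toReal_avgGreen (hω : Transient M κ ω) (n : ℕ) :
    (avgGreen (-(n : ℤ)) 0 ω).toReal = ((n + 1 : ℕ) : ℝ)⁻¹ *
      ∑ i ∈ Finset.range (n + 1), (green (-(i : ℤ)) 0 ω).toReal := by
  have hcard : (Finset.Icc (-(n : ℤ)) 0).card = n + 1 := by rw [Int.card_Icc]; omega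
  rw [avgGreen, hcard, ENNReal.toReal_div, ENNReal.toReal_natCast, div_eq_inv_mul,
    ENNReal.toReal_sum fun k _ => hω.green_ne_top k 0]
  congr 1
  refine Finset.sum_nbij' (fun k => (-k).toNat) (fun i => -(i : ℤ)) ?_ ?_ ?_ ?_ ?_
  · intro k hk; rw [Finset.mem_Icc] at hk; rw [Finset.mem_range]; omega
  · intro i hi; rw [Finset.mem_range] at hi; rw [Finset.mem_Icc]; omega
  · intro k hk; rw [Finset.mem_Icc] at hk; omega
  · intro i hi; omega
  · intro k hk
    rw [Finset.mem_Icc] at hk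
    rw [show -(((-k).toNat : ℕ) : ℤ) = k by omega]

theorem tendsto_avgGreen (hω : Transient M κ ω) :
    Tendsto (fun n : ℕ => (avgGreen (-(n : ℤ)) 0 ω).toReal) atTop (𝓝 (limitGreen ω).toReal) := by
  have h1 : Tendsto (fun n : ℕ => (green (-(n : ℤ)) 0 ω).toReal) atTop
      (𝓝 (limitGreen ω).toReal) :=
    (ENNReal.tendsto_toReal hω.limitGreen_ne_top).comp
      (hω.tendsto_green_zero.comp tendsto_neg_natCast)
  refine (h1.cesaro.comp (tendsto_add_atTop_nat 1)).congr fun n => ?_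
  rw [hω.toReal_avgGreen]
  rfl

theorem avgGreen_le (hω : Transient M κ ω) (n : ℕ) :
    avgGreen (-(n : ℤ)) 0 ω ≤ green 0 0 ω := by
  refine ENNReal.div_le_of_le_mul ?_
  rw [mul_comm, ← nsmul_eq_mul]
  exact Finset.sum_le_card_nsmul _ _ _ fun k _ => hω.green_le k 0

end Transient

namespace Setting

variable {P : Measure Env} [IsProbabilityMeasure P] {ε : ℝ}

theorem lintegral_green_ne_top (hS : Setting P M κ ε) (hP : MeasurePreserving (shift 1) P P) :
    ∫⁻ ω, green 0 0 ω ∂P ≠ ∞ := by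
  rw [lintegral_congr_ae (g := fun ω => pot M ω Set.univ (delta 0) 0)]
  · exact hS.lintegral_pot_univ_ne_top hP
  · filter_upwards [hS.regular] with ω hω using hω.green_eq_pot 0 0

theorem lintegral_limitGreen_ne_top (hS : Setting P M κ ε)
    (hP : MeasurePreserving (shift 1) P P) : ∫⁻ ω, limitGreen ω ∂P ≠ ∞ := by
  refine ne_top_of_le_ne_top (hS.lintegral_green_ne_top hP) (lintegral_mono_ae ?_)
  filter_upwards [hS.ae_transient hP] with ω hω using hω.limitGreen_le

theorem lintegral_limitGreen_pos (hS : Setting P M κ ε)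
    (hP : MeasurePreserving (shift 1) P P) : 0 < ∫⁻ ω, limitGreen ω ∂P := by
  have h1 : ∫⁻ _, ENNReal.ofReal κ ∂P ≤ ∫⁻ ω, limitGreen ω ∂P := by
    refine lintegral_mono_ae ?_
    filter_upwards [hS.ae_transient hP] with ω hω using hω.le_limitGreen
  refine lt_of_lt_of_le ?_ h1
  simpa using hS.pos

/-- The averaged Green functions converge almost surely and are dominated by `g_{00}`. -/
theorem tendstoWeaklyL1 (hS : Setting P M κ ε) (hP : MeasurePreserving (shift 1) P P) :
    TendstoWeaklyL1 P (fun n => avgGreen (-(n : ℤ)) 0) limitGreen := by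
  have hmeas : ∀ n : ℕ, Measurable (avgGreen (-(n : ℤ)) 0) := fun n =>
    (Finset.measurable_sum _ fun k _ => measurable_green k 0).div_const _
  have hgreen := hS.lintegral_green_ne_top hP
  refine ⟨fun n => ⟨(hmeas n).aemeasurable, ?_⟩, ⟨measurable_limitGreen.aemeasurable,
    (hS.lintegral_limitGreen_ne_top hP).lt_top⟩, ?_⟩
  · refine (lintegral_mono_ae ?_).trans_lt hgreen.lt_top
    filter_upwards [hS.ae_transient hP] with ω hω using hω.avgGreen_le n
  · rintro f hf ⟨C, hC⟩
    refine tendsto_integral_of_dominated_convergence (fun ω => (green 0 0 ω).toReal * C)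
      (fun n => ((hmeas n).ennreal_toReal.mul hf).aestronglyMeasurable)
      ((integrable_toReal_of_lintegral_ne_top (measurable_green 0 0).aemeasurable hgreen).mul_const
        C) (fun n => ?_) ?_
    · filter_upwards [hS.ae_transient hP] with ω hω
      rw [norm_mul, Real.norm_eq_abs, Real.norm_eq_abs, abs_of_nonneg ENNReal.toReal_nonneg]
      exact mul_le_mul (ENNReal.toReal_mono (hω.green_ne_top 0 0) (hω.avgGreen_le n)) (hC ω)
        (abs_nonneg _) ENNReal.toReal_nonneg
    · filter_upwards [hS.ae_transient hP] with ω hω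
      exact hω.tendsto_avgGreen.mul_const _

end Setting

/-- The invariant measure of the environment process. -/
noncomputable def invariantMeasure (P : Measure Env) : Measure Env :=
  P.withDensity fun ω => limitGreen ω / ∫⁻ ω', limitGreen ω' ∂P

theorem lintegral_envKernel (ω : Env) {f : Env → ℝ≥0∞} (hf : Measurable f) :
    ∫⁻ ω', f ω' ∂envKernel ω = ∑' e, ENNReal.ofReal (ω.1 0 e) * f (shift e ω) := by
  change ∫⁻ ω', f ω' ∂((row ω 0).map fun e => shift e ω) = _
  rw [lintegral_map hf Measurable.of_discrete, lintegral_row]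

namespace Setting

variable {P : Measure Env} [IsProbabilityMeasure P] {ε : ℝ}

theorem isProbabilityMeasure_invariantMeasure (hS : Setting P M κ ε)
    (hP : MeasurePreserving (shift 1) P P) : IsProbabilityMeasure (invariantMeasure P) := by
  constructor
  rw [invariantMeasure, withDensity_apply _ MeasurableSet.univ, Measure.restrict_univ]
  simp_rw [div_eq_mul_inv]
  rw [lintegral_mul_const _ measurable_limitGreen,
    ENNReal.mul_inv_cancel (hS.lintegral_limitGreen_pos hP).ne'
      (hS.lintegral_limitGreen_ne_top hP)]

/-- The substitution `ω ↦ T^{-e} ω`, which preserves `P`, moves the shift from the test set to the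
density. The density then appears as `∑ j, π_{j0} ρ(T^j ω)`, which is `ρ(ω)` by
`sum_mul_limitGreen`. -/
theorem invariant_invariantMeasure (hS : Setting P M κ ε)
    (hP : MeasurePreserving (shift 1) P P) : Kernel.Invariant envKernel (invariantMeasure P) := by
  set ρ : Env → ℝ≥0∞ := fun ω => limitGreen ω / ∫⁻ ω', limitGreen ω' ∂P with hρ
  have hρm : Measurable ρ := measurable_limitGreen.div_const _
  refine Measure.ext fun B hB => ?_
  have hker : ∀ ω, envKernel ω B =
      ∑' e, ENNReal.ofReal (ω.1 0 e) * B.indicator 1 (shift e ω) := by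
    intro ω
    rw [← lintegral_envKernel ω (measurable_one.indicator hB), lintegral_indicator_one hB]
  have hBm : Measurable (B.indicator (1 : Env → ℝ≥0∞)) := measurable_one.indicator hB
  have hterm : ∀ e, Measurable fun ω : Env =>
      ρ ω * (ENNReal.ofReal (ω.1 0 e) * B.indicator 1 (shift e ω)) := fun e =>
    hρm.mul ((measurable_entry 0 e).ennreal_ofReal.mul (hBm.comp (measurable_shift e)))
  rw [Measure.bind_apply hB envKernel.measurable.aemeasurable]
  change ∫⁻ ω, envKernel ω B ∂P.withDensity ρ = P.withDensity ρ B
  rw [lintegral_withDensity_eq_lintegral_mul _ hρm (envKernel.measurable_coe hB),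
    withDensity_apply _ hB, ← lintegral_indicator hB]
  simp only [Pi.mul_apply, hker]
  simp_rw [← ENNReal.tsum_mul_left]
  rw [lintegral_tsum fun e => (hterm e).aemeasurable]
  have hsh : ∀ e : ℤ, ∫⁻ ω, ρ ω * (ENNReal.ofReal (ω.1 0 e) * B.indicator 1 (shift e ω)) ∂P =
      ∫⁻ ω, B.indicator 1 ω * (ENNReal.ofReal (ω.1 (-e) 0) * ρ (shift (-e) ω)) ∂P := by
    intro e
    rw [← (measurePreserving_shift hP (-e)).lintegral_comp (hterm e)]
    refine lintegral_congr fun ω => ?_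
    rw [shift_shift, neg_add_cancel, shift_zero]
    have : (shift (-e) ω).1 0 e = ω.1 (-e) 0 := by simp [shift]
    rw [this]
    ring
  have hterm' : ∀ e : ℤ, Measurable fun ω : Env =>
      B.indicator 1 ω * (ENNReal.ofReal (ω.1 (-e) 0) * ρ (shift (-e) ω)) := fun e =>
    hBm.mul ((measurable_entry (-e) 0).ennreal_ofReal.mul (hρm.comp (measurable_shift (-e))))
  simp_rw [hsh]
  rw [← lintegral_tsum fun e => (hterm' e).aemeasurable]
  refine lintegral_congr_ae ?_
  filter_upwards [hS.ae_transient hP] with ω hω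
  have hneg := (Equiv.neg ℤ).tsum_eq fun j => ENNReal.ofReal (ω.1 j 0) * ρ (shift j ω)
  simp only [Equiv.neg_apply] at hneg
  rw [ENNReal.tsum_mul_left, hneg]
  have : ∑' j : ℤ, ENNReal.ofReal (ω.1 j 0) * ρ (shift j ω) = ρ ω := by
    simp only [hρ, div_eq_mul_inv, ← mul_assoc]
    rw [ENNReal.tsum_mul_right, hω.sum_mul_limitGreen]
  rw [this]
  by_cases h : ω ∈ B <;> simp [h]

end Setting

theorem integrable_drift {Q : Measure Env} [IsProbabilityMeasure Q]
    (h : ∀ᵐ ω ∂Q, Regular M κ ω) : Integrable drift Q := by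
  have hm : AEMeasurable drift Q := by
    simpa [shift_zero] using aemeasurable_drift_shift h 0
  refine Integrable.of_bound hm.aestronglyMeasurable (M : ℝ) ?_
  filter_upwards [h] with ω hω
  simpa [shift_zero] using hω.abs_drift_shift_le 0

/-! ### The maximal ergodic theorem. -/

section MaximalErgodic

variable {α : Type*} {θ : α → α} {f : α → ℝ}

/-- The running maximum `max(0, S_1 f, …, S_n f)` of the Birkhoff sums. -/
noncomputable def birkhoffMax (θ : α → α) (f : α → ℝ) : ℕ → α → ℝ
  | 0, _ => 0
  | n + 1, x => max 0 (f x + birkhoffMax θ f n (θ x))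

theorem birkhoffMax_nonneg (n : ℕ) (x : α) : 0 ≤ birkhoffMax θ f n x := by
  cases n with
  | zero => exact le_rfl
  | succ n => exact le_max_left _ _

theorem birkhoffMax_le_succ (n : ℕ) (x : α) :
    birkhoffMax θ f n x ≤ birkhoffMax θ f (n + 1) x := by
  induction n generalizing x with
  | zero => exact birkhoffMax_nonneg 1 x
  | succ n ih => exact max_le_max le_rfl (add_le_add_right (ih (θ x)) _)

theorem birkhoffSum_le_birkhoffMax (n : ℕ) (x : α) :
    birkhoffSum θ f n x ≤ birkhoffMax θ f n x := by
  induction n generalizing x with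
  | zero => simp [birkhoffMax]
  | succ n ih =>
    rw [birkhoffSum_succ']
    exact (add_le_add_right (ih (θ x)) _).trans (le_max_right _ _)

/-- The maximal ergodic theorem. -/
theorem integral_nonneg_of_birkhoffSum_pos [MeasurableSpace α] {μ : Measure α}
    [IsFiniteMeasure μ] (hθ : MeasurePreserving θ μ μ)
    (hf : Integrable f μ) (hfm : Measurable f)
    (hpos : ∀ᵐ x ∂μ, ∃ n, 0 < birkhoffSum θ f n x) :
    0 ≤ ∫ x, f x ∂μ := by
  have hmeas : ∀ n, Measurable (birkhoffMax θ f n) := by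
    intro n
    induction n with
    | zero => exact measurable_const
    | succ n ih => exact measurable_const.max (hfm.add (ih.comp hθ.measurable))
  have hint : ∀ n, Integrable (birkhoffMax θ f n) μ := by
    intro n
    induction n with
    | zero => exact integrable_zero _ _ _
    | succ n ih => exact (integrable_zero _ _ _).sup (hf.add (hθ.integrable_comp_of_integrable ih))
  set E : ℕ → Set α := fun n => {x | 0 < birkhoffMax θ f (n + 1) x} with hE
  have hEm : ∀ n, MeasurableSet (E n) := fun n => measurableSet_lt measurable_const (hmeas _)
  have hstep : ∀ n, 0 ≤ ∫ x in E n, f x ∂μ := by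
    intro n
    have hcomp : Integrable (fun x => birkhoffMax θ f (n + 1) (θ x)) μ :=
      hθ.integrable_comp_of_integrable (hint (n + 1))
    -- Garsia's argument: where the running maximum is positive it equals `f` plus the previous
    -- maximum at `θ x`, so `f` dominates the difference of the maximum at `x` and at `θ x`. Off `E
    -- n` the maximum at `x` vanishes, and invariance of `μ` makes the integral of the difference
    -- nonnegative.
    have h1 : ∫ x in E n, (birkhoffMax θ f (n + 1) x - birkhoffMax θ f (n + 1) (θ x)) ∂μ ≤
        ∫ x in E n, f x ∂μ := by
      refine setIntegral_mono_on ((hint (n + 1)).sub hcomp).integrableOn hf.integrableOn (hEm n)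
        fun x hx => ?_
      have h2 : birkhoffMax θ f (n + 1) x = f x + birkhoffMax θ f n (θ x) := by
        have h3 : birkhoffMax θ f (n + 1) x = max 0 (f x + birkhoffMax θ f n (θ x)) := rfl
        have h4 : 0 < birkhoffMax θ f (n + 1) x := hx
        rw [h3] at h4 ⊢
        rcases max_choice 0 (f x + birkhoffMax θ f n (θ x)) with h | h
        · rw [h] at h4; exact absurd h4 (lt_irrefl _)
        · exact h
      have := birkhoffMax_le_succ (θ := θ) (f := f) n (θ x)
      linarith
    refine le_trans ?_ h1
    rw [integral_sub (hint (n + 1)).integrableOn hcomp.integrableOn]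
    have h5 : ∫ x in E n, birkhoffMax θ f (n + 1) x ∂μ = ∫ x, birkhoffMax θ f (n + 1) x ∂μ := by
      refine setIntegral_eq_integral_of_forall_compl_eq_zero fun x hx => ?_
      exact le_antisymm (not_lt.1 hx) (birkhoffMax_nonneg _ _)
    have h6 : ∫ x in E n, birkhoffMax θ f (n + 1) (θ x) ∂μ ≤
        ∫ x, birkhoffMax θ f (n + 1) (θ x) ∂μ :=
      setIntegral_le_integral hcomp (Eventually.of_forall fun x => birkhoffMax_nonneg _ _)
    have h7 : ∫ x, birkhoffMax θ f (n + 1) (θ x) ∂μ = ∫ x, birkhoffMax θ f (n + 1) x ∂μ := by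
      conv_rhs => rw [← hθ.map_eq]
      rw [integral_map hθ.measurable.aemeasurable (hmeas _).aestronglyMeasurable]
    linarith
  have hmono : Monotone E := monotone_nat_of_le_succ fun n x hx =>
    lt_of_lt_of_le hx (birkhoffMax_le_succ (n + 1) x)
  have hlim := tendsto_setIntegral_of_monotone hEm hmono (f := f) (μ := μ) hf.integrableOn
  have hall : (⋃ n, E n) =ᵐ[μ] Set.univ := by
    rw [eventuallyEq_univ]
    filter_upwards [hpos] with x hx
    obtain ⟨n, hn⟩ := hx
    exact Set.mem_iUnion.2 ⟨n, (hn.trans_le (birkhoffSum_le_birkhoffMax n x)).trans_le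
      (birkhoffMax_le_succ n x)⟩
  rw [setIntegral_congr_set hall, setIntegral_univ] at hlim
  exact ge_of_tendsto' hlim hstep

end MaximalErgodic


/-! ### The law of large numbers. -/

/-- The paths for which `s X_n - c n` is unbounded from above. -/
def fastPaths (s c : ℝ) : Set (ℕ → ℤ) :=
  {X | ∀ b : ℕ, ∃ᶠ n : ℕ in atTop, c * n + b < s * X n}

theorem measurableSet_fastPaths (s c : ℝ) : MeasurableSet (fastPaths s c) := by
  have : fastPaths s c =
      ⋂ b : ℕ, limsup (fun n : ℕ => {X : ℕ → ℤ | c * n + b < s * X n}) atTop := by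
    ext X
    simp only [fastPaths, Set.mem_ofPred_eq, Set.mem_iInter, mem_limsup_iff_frequently_mem]
  rw [this]
  refine MeasurableSet.iInter fun b => MeasurableSet.measurableSet_limsup fun n => ?_
  exact measurableSet_lt measurable_const
    ((Measurable.of_discrete (f := fun z : ℤ => s * z)).comp (measurable_pi_apply n))

/-- Asking for every level `b` makes the event insensitive to bounded perturbations and to time
shifts; the level `b'` absorbs the change `c * (a' - a)` and the constant `C`. -/
theorem mem_fastPaths_of_le {s c C : ℝ} {X Y : ℕ → ℤ} (a a' : ℕ)
    (h : ∀ n, s * X (n + a) ≤ s * Y (n + a') + C) (hX : X ∈ fastPaths s c) :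
    Y ∈ fastPaths s c := by
  intro b
  obtain ⟨b', hb'⟩ := exists_nat_ge (b + c * a' - c * a + C)
  have h1 := hX b'
  rw [← map_add_atTop_eq_nat a, frequently_map] at h1
  rw [← map_add_atTop_eq_nat a', frequently_map]
  refine h1.mono fun n hn => ?_
  have := h n
  push_cast at hn ⊢
  linarith

theorem mem_fastPaths_iff {s c : ℝ} {X Y : ℕ → ℤ} (a a' : ℕ) (d : ℤ)
    (h : ∀ n, X (n + a) = Y (n + a') + d) : X ∈ fastPaths s c ↔ Y ∈ fastPaths s c := by
  refine ⟨mem_fastPaths_of_le (C := s * d) a a' fun n => ?_,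
    mem_fastPaths_of_le (C := -(s * d)) a' a fun n => ?_⟩
  · rw [h]; push_cast; linarith
  · rw [h]; push_cast; linarith

theorem consPath_preimage_fastPaths (s c : ℝ) (x : ℤ) :
    consPath x ⁻¹' fastPaths s c = fastPaths s c := by
  ext Y
  exact mem_fastPaths_iff 1 0 0 fun n => by simp [consPath]

theorem sub_preimage_fastPaths (s c : ℝ) (k : ℤ) :
    (fun (X : ℕ → ℤ) n => X n - k) ⁻¹' fastPaths s c = fastPaths s c := by
  ext Y
  exact mem_fastPaths_iff 0 0 (-k) fun n => by simp [sub_eq_add_neg]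

/-- The shift of the increments of a path. -/
def incrementShift (X : ℕ → ℤ) : ℕ → ℤ := fun n => X (n + 1) - X 1

theorem measurable_incrementShift : Measurable incrementShift :=
  measurable_pi_lambda _ fun n =>
    (measurable_pi_apply (n + 1)).sub (measurable_pi_apply 1)

theorem incrementShift_preimage_fastPaths (s c : ℝ) :
    incrementShift ⁻¹' fastPaths s c = fastPaths s c := by
  ext Y
  exact mem_fastPaths_iff 0 1 (-Y 1) fun n => by simp [incrementShift, sub_eq_add_neg]

/-- The increments telescope. The index starts at `1` because `X 0` is arbitrary here and does not
enter the sums. -/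
theorem birkhoffSum_incrementShift (s c : ℝ) (n : ℕ) (X : ℕ → ℤ) :
    birkhoffSum incrementShift (fun X => s * X 1 - c) (n + 1) X = s * X (n + 1) - c * (n + 1) := by
  induction n generalizing X with
  | zero => simp [birkhoffSum]
  | succ n ih =>
    rw [birkhoffSum_succ', ih]
    simp only [incrementShift]
    push_cast
    ring

theorem ae_quenchedLaw_zero (ω : Env) (x : ℤ) : ∀ᵐ X ∂quenchedLaw ω x, X 0 = x := by
  have h := quenchedLaw_cylinder ω x 0 fun _ => x
  simp only [Nat.le_zero, forall_eq, if_true, Finset.range_zero, Finset.prod_empty,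
    mul_one] at h
  have hm : MeasurableSet {X : ℕ → ℤ | X 0 = x} :=
    measurableSet_eq_fun (measurable_pi_apply 0) measurable_const
  rw [ae_iff, ← Set.compl_ofPred, prob_compl_eq_zero_iff hm]
  exact h

/-- The probability of `fastPaths` does not depend on the starting point. -/
theorem Transient.quenchedLaw_fastPaths (hω : Transient M κ ω) (s c : ℝ) (x y : ℤ) :
    quenchedLaw ω x (fastPaths s c) = quenchedLaw ω y (fastPaths s c) := by
  have hfin : ∀ e, quenchedLaw ω e (fastPaths s c) ≠ ∞ := fun e => measure_ne_top _ _
  -- Removing the first step does not change the event, so its probability is a bounded harmonic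
  -- function of the starting point, and the Liouville property applies.
  have h := hω.harmonic_eq (h := fun e => (quenchedLaw ω e (fastPaths s c)).toReal) (a := 0) (b := 1)
    (fun i => ?_) (fun i => ⟨ENNReal.toReal_nonneg, measureReal_le_one⟩) x y
  · exact (ENNReal.toReal_eq_toReal_iff' (hfin x) (hfin y)).1 h
  · rw [← toReal_avg hfin, ← hω.regular.tsum_row]
    congr 1
    conv_rhs => rw [quenchedLaw_apply ω i (measurableSet_fastPaths s c)]
    simp_rw [consPath_preimage_fastPaths]

/-- Given `fastPaths`, the first step has its unconditional law. -/
theorem Transient.map_restrict_fastPaths (hω : Transient M κ ω) (s c : ℝ) :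
    ((quenchedLaw ω 0).restrict (fastPaths s c)).map (fun X => X 1) =
      quenchedLaw ω 0 (fastPaths s c) • row ω 0 := by
  refine Measure.ext_of_singleton fun e => ?_
  have hm1 : Measurable fun X : ℕ → ℤ => X 1 := measurable_pi_apply 1
  have hB := measurableSet_fastPaths s c
  rw [Measure.map_apply hm1 (measurableSet_singleton e),
    Measure.restrict_apply (hm1 (measurableSet_singleton e)),
    quenchedLaw_apply ω 0 ((hm1 (measurableSet_singleton e)).inter hB), Measure.smul_apply,
    row_singleton, smul_eq_mul]
  simp_rw [Set.preimage_inter, consPath_preimage_fastPaths]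
  rw [tsum_eq_single e]
  · rw [mul_comm]
    congr 1
    -- Conditioning on the event would reweight a step to `e` by the ratio of its probabilities from
    -- `e` and from `0`, which is `1`.
    rw [hω.quenchedLaw_fastPaths s c 0 e]
    refine measure_congr ?_
    filter_upwards [ae_quenchedLaw_zero ω e] with X hX
    refine propext ⟨fun h => h.2, fun h => ⟨?_, h⟩⟩
    simpa [consPath] using hX
  · intro e' he'
    have : quenchedLaw ω e' (consPath 0 ⁻¹' ((fun X : ℕ → ℤ => X 1) ⁻¹' {e}) ∩ fastPaths s c) = 0 := by
      refine measure_mono_null Set.inter_subset_left ?_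
      have h0 := ae_quenchedLaw_zero ω e'
      rw [ae_iff] at h0
      refine measure_mono_null (fun X hX => ?_) h0
      have : X 0 = e := by simpa [consPath] using hX
      simp only [Set.mem_ofPred_eq, this]
      exact he'.symm
    rw [this, mul_zero]

theorem Regular.ae_row (hω : Regular M κ ω) : ∀ᵐ e ∂row ω 0, |e| ≤ (M : ℤ) := by
  rw [ae_iff, row_apply]
  refine ENNReal.tsum_eq_zero.2 fun e => ?_
  by_cases he : |e| ≤ (M : ℤ)
  · simp [he]
  · rw [hω.range 0 e (by simpa using he)]; simp

theorem Regular.integrable_row (hω : Regular M κ ω) : Integrable (fun e : ℤ => (e : ℝ)) (row ω 0) := by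
  refine Integrable.of_bound Measurable.of_discrete.aestronglyMeasurable (M : ℝ) ?_
  filter_upwards [hω.ae_row] with e he
  rw [Real.norm_eq_abs]
  exact_mod_cast he

theorem Regular.integral_row (hω : Regular M κ ω) : ∫ e : ℤ, (e : ℝ) ∂row ω 0 = drift ω := by
  rw [integral_countable hω.integrable_row, drift]
  refine tsum_congr fun e => ?_
  rw [measureReal_def, row_singleton, ENNReal.toReal_ofReal (ω.2.1 0 e).1, smul_eq_mul, mul_comm]

theorem Transient.setIntegral_fastPaths (hω : Transient M κ ω) (s c : ℝ) :
    ∫ X in fastPaths s c, (s * X 1 - c) ∂quenchedLaw ω 0 =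
      (quenchedLaw ω 0 (fastPaths s c)).toReal * (s * drift ω - c) := by
  have h1 : ∫ X in fastPaths s c, (s * X 1 - c) ∂quenchedLaw ω 0 =
      ∫ e : ℤ, (s * e - c) ∂((quenchedLaw ω 0).restrict (fastPaths s c)).map (fun X => X 1) := by
    rw [integral_map (measurable_pi_apply 1).aemeasurable
      Measurable.of_discrete.aestronglyMeasurable]
  rw [h1, hω.map_restrict_fastPaths, integral_smul_measure, smul_eq_mul,
    integral_sub (hω.regular.integrable_row.const_mul s) (integrable_const c), integral_const_mul,
    hω.regular.integral_row]
  simp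

theorem annealedLaw_snd_apply (Q : Measure Env) [IsProbabilityMeasure Q] {B : Set (ℕ → ℤ)}
    (hB : MeasurableSet B) : (annealedLaw Q 0).snd B = ∫⁻ ω, quenchedLaw ω 0 B ∂Q := by
  rw [Measure.snd_apply hB, annealedLaw, Measure.compProd_apply (measurable_snd hB)]
  rfl

instance (Q : Measure Env) [IsProbabilityMeasure Q] (x : ℤ) :
    IsProbabilityMeasure (annealedLaw Q x) := by
  unfold annealedLaw; infer_instance

theorem quenchedLaw_incrementShift (ω : Env) {B : Set (ℕ → ℤ)} (hB : MeasurableSet B) :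
    quenchedLaw ω 0 (incrementShift ⁻¹' B) =
      ∑' e, ENNReal.ofReal (ω.1 0 e) * quenchedLaw (shift e ω) 0 B := by
  rw [quenchedLaw_apply ω 0 (measurable_incrementShift hB)]
  refine tsum_congr fun e => ?_
  congr 1
  rw [quenchedLaw_shift, add_zero, Measure.map_apply (measurable_sub_path e) hB]
  refine measure_congr ?_
  filter_upwards [ae_quenchedLaw_zero ω e] with Y hY
  have : incrementShift (consPath 0 Y) = fun n => Y n - e := by
    funext n
    simp [incrementShift, consPath, hY]
  change (incrementShift (consPath 0 Y) ∈ B) = ((fun n => Y n - e) ∈ B)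
  rw [this]

/-- Under the annealed law of an invariant measure of the environment process, the increments of
the walk are stationary. -/
theorem measurePreserving_incrementShift {Q : Measure Env} [IsProbabilityMeasure Q]
    (hQ : Kernel.Invariant envKernel Q) :
    MeasurePreserving incrementShift (annealedLaw Q 0).snd (annealedLaw Q 0).snd := by
  refine ⟨measurable_incrementShift, Measure.ext fun B hB => ?_⟩
  have hφ : Measurable fun ω => quenchedLaw ω 0 B :=
    (Measure.measurable_coe hB).comp (measurable_quenchedLaw 0)
  rw [Measure.map_apply measurable_incrementShift hB,
    annealedLaw_snd_apply Q (measurable_incrementShift hB), annealedLaw_snd_apply Q hB]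
  simp_rw [quenchedLaw_incrementShift _ hB]
  conv_rhs => rw [← hQ.def, Measure.lintegral_bind envKernel.measurable.aemeasurable
    hφ.aemeasurable]
  exact lintegral_congr fun ω => (lintegral_envKernel ω hφ).symm

theorem ae_abs_le_annealedLaw {Q : Measure Env} [IsProbabilityMeasure Q]
    (hreg : ∀ᵐ ω ∂Q, Transient M κ ω) : ∀ᵐ X ∂(annealedLaw Q 0).snd, |X 1| ≤ (M : ℤ) := by
  have hm1 : Measurable fun X : ℕ → ℤ => X 1 := measurable_pi_apply 1
  have hm : MeasurableSet {X : ℕ → ℤ | ¬ |X 1| ≤ (M : ℤ)} :=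
    hm1 (MeasurableSet.of_discrete (s := {z : ℤ | ¬ |z| ≤ (M : ℤ)}))
  rw [ae_iff, annealedLaw_snd_apply Q hm]
  refine (lintegral_congr_ae (g := fun _ => 0) ?_).trans lintegral_zero
  filter_upwards [hreg] with ω hω
  rw [quenchedLaw_apply ω 0 hm]
  refine ENNReal.tsum_eq_zero.2 fun e => ?_
  by_cases he : |e| ≤ (M : ℤ)
  · refine mul_eq_zero_of_right _ (measure_mono_null (fun X hX => ?_)
      (ae_iff.1 (ae_quenchedLaw_zero ω e)))
    intro h
    have h1 : ¬ |X 0| ≤ (M : ℤ) := hX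
    exact h1 (h ▸ he)
  · rw [hω.regular.range 0 e (by simpa using he)]; simp

theorem setIntegral_annealedLaw {Q : Measure Env} [IsProbabilityMeasure Q]
    (hreg : ∀ᵐ ω ∂Q, Transient M κ ω) (s c : ℝ) {p : ℝ≥0∞}
    (hp : ∀ᵐ ω ∂Q, quenchedLaw ω 0 (fastPaths s c) = p) :
    IntegrableOn (fun X : ℕ → ℤ => s * X 1 - c) (fastPaths s c) (annealedLaw Q 0).snd ∧
    ∫ X in fastPaths s c, (s * X 1 - c) ∂(annealedLaw Q 0).snd =
      p.toReal * (s * ∫ ω, drift ω ∂Q - c) := by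
  have hB := measurableSet_fastPaths s c
  have hfm : Measurable fun X : ℕ → ℤ => s * X 1 - c :=
    (Measurable.of_discrete (f := fun z : ℤ => s * z - c)).comp (measurable_pi_apply 1)
  have hint : Integrable (fun X : ℕ → ℤ => s * X 1 - c) (annealedLaw Q 0).snd := by
    refine Integrable.of_bound hfm.aestronglyMeasurable (|s| * M + |c|) ?_
    filter_upwards [ae_abs_le_annealedLaw hreg] with X hX
    have h1 : |(X 1 : ℝ)| ≤ M := by exact_mod_cast hX
    calc ‖s * X 1 - c‖ ≤ ‖s * (X 1 : ℝ)‖ + ‖c‖ := norm_sub_le _ _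
      _ = |s| * |(X 1 : ℝ)| + |c| := by rw [norm_mul]; rfl
      _ ≤ |s| * M + |c| := by gcongr
  refine ⟨hint.integrableOn, ?_⟩
  have hint' : Integrable (fun q : Env × (ℕ → ℤ) =>
      (fastPaths s c).indicator (fun X => s * X 1 - c) q.2) (annealedLaw Q 0) :=
    (hint.indicator hB).comp_measurable measurable_snd
  rw [← integral_indicator hB, Measure.snd, integral_map measurable_snd.aemeasurable
    (hfm.indicator hB).aestronglyMeasurable]
  rw [annealedLaw] at hint' ⊢
  rw [Measure.integral_compProd hint']
  have hdrift := integrable_drift (hreg.mono fun ω hω => hω.regular)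
  have hinner : ∀ᵐ ω ∂Q, ∫ X, (fastPaths s c).indicator (fun X => s * X 1 - c) X
      ∂quenchedKernel 0 ω = p.toReal * (s * drift ω - c) := by
    filter_upwards [hreg, hp] with ω hω hpω
    rw [integral_indicator hB, ← hpω]
    exact hω.setIntegral_fastPaths s c
  rw [integral_congr_ae hinner, integral_const_mul, integral_sub (hdrift.const_mul s)
    (integrable_const c), integral_const_mul]
  simp

/-- The Liouville property and ergodicity of `P` make the quenched probability a constant `p`,
`P`-almost surely and so `Q`-almost surely. Stationarity of the increments under `Q` and the maximal
ergodic theorem on this shift-invariant event give `0 ≤ p * (s * v - c)`, with `v` the mean drift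
under `Q`. Hence `p = 0`, and since `p` is also the constant under `P`, no comparison of `P` by `Q`
is required. -/
theorem Setting.ae_fastPaths_eq_zero {P Q : Measure Env} [IsProbabilityMeasure P]
    [IsProbabilityMeasure Q] {ε : ℝ} (hS : Setting P M κ ε) (hErg : Ergodic (shift 1) P)
    (hQ : Kernel.Invariant envKernel Q) (hQP : Q ≪ P) {s c : ℝ} (hc : s * ∫ ω, drift ω ∂Q < c) :
    ∀ᵐ ω ∂P, quenchedLaw ω 0 (fastPaths s c) = 0 := by
  have hB := measurableSet_fastPaths s c
  have htr := hS.ae_transient hErg.toMeasurePreserving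
  have hφ : Measurable fun ω => quenchedLaw ω 0 (fastPaths s c) :=
    (Measure.measurable_coe hB).comp (measurable_quenchedLaw 0)
  obtain ⟨p, hp⟩ := hErg.ae_eq_const_of_ae_eq_comp_ae (g := fun ω => quenchedLaw ω 0 (fastPaths s c))
    hφ.aestronglyMeasurable (by
      filter_upwards [htr] with ω hω
      simp only [Function.comp_apply]
      rw [quenchedLaw_shift, Measure.map_apply (measurable_sub_path 1) hB, sub_preimage_fastPaths]
      exact hω.quenchedLaw_fastPaths s c _ _)
  have hpP : ∀ᵐ ω ∂P, quenchedLaw ω 0 (fastPaths s c) = p := hp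
  have hp_top : p ≠ ∞ := by
    obtain ⟨ω, hω⟩ := hpP.exists
    rw [← hω]; exact measure_ne_top _ _
  obtain ⟨hint, heq⟩ := setIntegral_annealedLaw (hQP.ae_le htr) s c (hQP.ae_le hpP)
  have hθ : MeasurePreserving incrementShift ((annealedLaw Q 0).snd.restrict (fastPaths s c))
      ((annealedLaw Q 0).snd.restrict (fastPaths s c)) := by
    have := (measurePreserving_incrementShift hQ).restrict_preimage hB
    rwa [incrementShift_preimage_fastPaths] at this
  have hpos : 0 ≤ ∫ X in fastPaths s c, (s * X 1 - c) ∂(annealedLaw Q 0).snd := by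
    refine integral_nonneg_of_birkhoffSum_pos hθ hint
      ((Measurable.of_discrete (f := fun z : ℤ => s * z - c)).comp (measurable_pi_apply 1)) ?_
    filter_upwards [ae_restrict_mem hB] with X hX
    -- The level `b = 0` at some time `n ≥ 1` already gives a positive Birkhoff sum.
    obtain ⟨n, hn1, hn⟩ := ((hX 0).and_eventually (eventually_ge_atTop 1)).exists
    obtain ⟨m, rfl⟩ : ∃ m, n = m + 1 := ⟨n - 1, by omega⟩
    refine ⟨m + 1, ?_⟩
    rw [birkhoffSum_incrementShift]
    push_cast at hn1
    linarith
  rw [heq] at hpos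
  have hp0 : p = 0 := by
    by_contra h
    have := ENNReal.toReal_pos h hp_top
    nlinarith
  rw [← hp0]
  exact hpP

/-- Linear bounds with slopes arbitrarily close to `v` on both sides give the speed `v`. -/
theorem tendsto_div_of_notMem_fastPaths {X : ℕ → ℤ} {v : ℝ}
    (h1 : ∀ k : ℕ, X ∉ fastPaths 1 (v + 1 / (k + 1)))
    (h2 : ∀ k : ℕ, X ∉ fastPaths (-1) (-v + 1 / (k + 1))) :
    Tendsto (fun n : ℕ => (X n : ℝ) / n) atTop (𝓝 v) := by
  rw [Metric.tendsto_atTop']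
  intro δ hδ
  -- Half of `δ` pays for the excess slope `1 / (k + 1)`, the other half for the additive level `b`
  -- once `n > 2 b / δ`.
  obtain ⟨k, hk⟩ := exists_nat_one_div_lt (half_pos hδ)
  have key : ∀ {s w : ℝ}, X ∉ fastPaths s (w + 1 / (k + 1)) →
      ∀ᶠ n : ℕ in atTop, s * X n < (w + δ) * n := by
    intro s w h
    simp only [fastPaths, Set.mem_ofPred_eq, not_forall, not_frequently, not_lt] at h
    obtain ⟨b, hb⟩ := h
    obtain ⟨N, hN⟩ := exists_nat_gt (b / (δ / 2))
    filter_upwards [hb, eventually_ge_atTop N] with n hn hNn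
    have h3 : (N : ℝ) ≤ n := by exact_mod_cast hNn
    rw [div_lt_iff₀ (half_pos hδ)] at hN
    have h4 : (1 / ((k : ℝ) + 1)) * n ≤ δ / 2 * n := mul_le_mul_of_nonneg_right hk.le n.cast_nonneg
    nlinarith
  obtain ⟨N, hN⟩ := eventually_atTop.1 ((key (h1 k)).and (key (h2 k)))
  refine ⟨N, fun n hn => ?_⟩
  obtain ⟨h3, h4⟩ := hN n hn.le
  have hn0 : (0 : ℝ) < n := by
    exact_mod_cast lt_of_le_of_lt (Nat.zero_le N) hn
  rw [Real.dist_eq, abs_lt, lt_sub_iff_add_lt, sub_lt_iff_lt_add, lt_div_iff₀ hn0, div_lt_iff₀ hn0]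
  constructor <;> linarith

end RWRE

theorem mainTheorem3 (P : Measure Env) [IsProbabilityMeasure P]
    (hErg : Ergodic (shift 1) P) (M : ℕ) (hRange : FiniteRange P M)
    (hKal : KalikowCondition P M) :
    ∃ Pinf : Measure Env,
      IsProbabilityMeasure Pinf ∧
      Kernel.Invariant envKernel Pinf ∧
      Pinf ≪ P ∧
      (∃ (φ : ℕ → ℕ) (m : Env → ℝ≥0∞), StrictMono φ ∧
        TendstoWeaklyL1 P (fun n => avgGreen (-(φ n : ℤ)) 0) m ∧
        0 < ∫⁻ ω, m ω ∂P ∧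
        Pinf = P.withDensity (fun ω => m ω / ∫⁻ ω', m ω' ∂P)) ∧
      Integrable drift Pinf ∧
      ∀ᵐ q ∂annealedLaw P 0,
        Tendsto (fun n : ℕ => (q.2 n : ℝ) / n) atTop (𝓝 (∫ ω, drift ω ∂Pinf)) := by
  obtain ⟨κ, ε, hS⟩ := hKal.setting hRange
  have hP := hErg.toMeasurePreserving
  have hprob := hS.isProbabilityMeasure_invariantMeasure hP
  have hinv := hS.invariant_invariantMeasure hP
  have hac : invariantMeasure P ≪ P := withDensity_absolutelyContinuous _ _
  refine ⟨invariantMeasure P, hprob, hinv, hac,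
    -- The averages converge along the whole sequence, so the subsequence is the identity.
    ⟨id, limitGreen, strictMono_id, hS.tendstoWeaklyL1 hP, hS.lintegral_limitGreen_pos hP, rfl⟩,
    integrable_drift (hac.ae_le hS.regular), ?_⟩
  set v := ∫ ω, drift ω ∂invariantMeasure P
  have hnull : ∀ {s c : ℝ}, s * v < c → ∀ᵐ q ∂annealedLaw P 0, q.2 ∉ fastPaths s c := by
    intro s c hc
    have hB := measurableSet_fastPaths s c
    have h0 : (annealedLaw P 0).snd (fastPaths s c) = 0 := by
      rw [annealedLaw_snd_apply P hB, lintegral_congr_ae (hS.ae_fastPaths_eq_zero hErg hinv hac hc),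
        lintegral_zero]
    rw [Measure.snd_apply hB] at h0
    rw [ae_iff]
    simp only [not_not]
    exact h0
  have hpos : ∀ k : ℕ, 0 < 1 / ((k : ℝ) + 1) := fun k => Nat.one_div_pos_of_nat
  have h1 := ae_all_iff.2 fun k : ℕ => hnull (s := 1) (c := v + 1 / (k + 1)) (by linarith [hpos k])
  have h2 := ae_all_iff.2 fun k : ℕ =>
    hnull (s := -1) (c := -v + 1 / (k + 1)) (by linarith [hpos k])
  filter_upwards [h1, h2] with q hq1 hq2
  exact tendsto_div_of_notMem_fastPaths hq1 hq2
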